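/- **Theorem (Dirichlet-like form of $\phi$ diagonalizes over the Gegenbauer basis).** Let $B\ge 4$ be an integer, let $S^{B-2}$ be the unit sphere of $\mathbb{R}^{B-1}$, and let $u_1,u_2\in S^{B-2}$. For $l\ge 0$ let $C_l^{(\alpha)}$ be the Gegenbauer polynomials: $C_0^{(\alpha)}=1$, $C_1^{(\alpha)}(x)=2\alpha x$ and $l\,C_l^{(\alpha)}(x)=2(l-1+\alpha)\,x\,C_{l-1}^{(\alpha)}(x)-(l-2+2\alpha)\,C_{l-2}^{(\alpha)}(x)$ for $l\ge2$; and put $c_{B-1,l}=\frac{B-3}{B-3+2l}$. Let $\phi$ be a real function with weak derivative $\phi'$ on $(-\sqrt{B-1},\sqrt{B-1})$. Suppose that $x\mapsto\phi(\sqrt{B-1}\,x)$ and $x\mapsto\phi'(\sqrt{B-1}\,x)$ both belong to the weighted space $L^2\big((-1,1),(1-x^2)^{\frac{B-3}{2}}dx\big)$, and that $\phi(\sqrt{B-1}\,x)$ has the Gegenbauer expansion $$\phi(\sqrt{B-1}\,x)=\sum_{l=0}^\infty a_l\,\frac{1}{c_{B-1,l}}\,C_l^{\left(\frac{B-3}{2}\right)}(x),\qquad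 a_l\in\mathbb{R},$$ with convergence in this space. Then, with $v$ uniformly distributed on $S^{B-2}$, $$\mathbb{E}_{v\in S^{B-2}}\Big[\big(u_1\cdot u_2-(u_1\cdot v)(u_2\cdot v)\big)\,\phi'(\sqrt{B-1}\,u_1\cdot v)\,\phi'(\sqrt{B-1}\,u_2\cdot v)\Big] =\sum_{l=0}^\infty a_l^2\,\frac{l+B-3}{B-1}\,l\,c_{B-1,l}^{-1}\,C_l^{\left(\frac{B-3}{2}\right)}(u_1\cdot u_2),$$ where the random variable on the left is integrable and the series on the right converges absolutely. -/

import Mathlib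

open MeasureTheory Filter Topology Polynomial
open scoped ENNReal ContDiff

noncomputable section

/-- The Gegenbauer polynomial `C_l^{(α)}`, by the classical three-term recurrence
`l C_l = 2 (l - 1 + α) x C_{l-1} - (l - 2 + 2 α) C_{l-2}`, `C_0 = 1`, `C_1 = 2 α x`.
For `α > 0` these are the orthogonal polynomials for the weight `(1 - x ^ 2) ^ (α - 1/2)` on
`[-1, 1]` in their usual normalization. -/
def gegenbauerPoly (α : ℝ) : ℕ → ℝ[X]
  | 0 => 1
  | 1 => C (2 * α) * X
  | (n + 2) =>
      C (((n : ℝ) + 2)⁻¹) *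
        (C (2 * ((n : ℝ) + 1 + α)) * X * gegenbauerPoly α (n + 1)
          - C ((n : ℝ) + 2 * α) * gegenbauerPoly α n)

/-- The constant `c_{N, l} = (N - 2) / (N + 2 l - 2)`. -/
def zonalConst (N : ℝ) (l : ℕ) : ℝ := (N - 2) / (N + 2 * (l : ℝ) - 2)

/-- The measure `(1 - x ^ 2) ^ β dx` on the interval `(-1, 1)`. -/
def gegenbauerMeasure (β : ℝ) : Measure ℝ :=
  (volume.restrict (Set.Ioo (-1 : ℝ) 1)).withDensity
    (fun x => ENNReal.ofReal ((1 - x ^ 2) ^ β))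

/-- On `(-1, 1)`, the function `f` has the Gegenbauer expansion
`∑ l, a l * c_{B-1, l}⁻¹ * C_l^{((B-3)/2)}`, with convergence in
`L² ((1 - x ^ 2) ^ ((B - 3) / 2))`. -/
def HasGegenbauerExpansion (B : ℕ) (f : ℝ → ℝ) (a : ℕ → ℝ) : Prop :=
  Tendsto
    (fun n : ℕ =>
      eLpNorm
        (fun x => f x - ∑ l ∈ Finset.range n,
          a l * (zonalConst ((B : ℝ) - 1) l)⁻¹ *
            (gegenbauerPoly (((B : ℝ) - 3) / 2) l).eval x)
        2 (gegenbauerMeasure (((B : ℝ) - 3) / 2)))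
    atTop (𝓝 0)

/-- `g` is a weak (distributional) derivative of `f` on the open set `U ⊆ ℝ`. -/
structure IsWeakDerivOn (U : Set ℝ) (f g : ℝ → ℝ) : Prop where
  locallyIntegrableOn : LocallyIntegrableOn f U volume
  locallyIntegrableOn_deriv : LocallyIntegrableOn g U volume
  integral_eq : ∀ ψ : ℝ → ℝ, ContDiff ℝ ∞ ψ → HasCompactSupport ψ → tsupport ψ ⊆ U →
    ∫ x in U, f x * deriv ψ x = - ∫ x in U, g x * ψ x

/-- The (unnormalized) rotation-invariant surface measure on the unit sphere of `ℝ^d`; averages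
`⨍` against it are expectations for the uniform distribution on the sphere `S^{d-1}`. -/
def sphereMeasure (d : ℕ) :
    Measure (Metric.sphere (0 : EuclideanSpace ℝ (Fin d)) 1) :=
  (volume : Measure (EuclideanSpace ℝ (Fin d))).toSphere

end

/-! ### Gegenbauer polynomials: first-order relations, differential equation, spanning property. -/

section GegenbauerPolynomials

variable (α : ℝ)

/-! Put α = (B-3)/2, so that the sphere lies in dimension 2α + 2. The kernel u·w - (u·v)(w·v) is the
inner product of the tangential projections of u and w at v. So the left-hand side is, up to
rescaling by √(B-1), the L² inner product of the gradients of the zonal functions f(u₁·v) and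
f(u₂·v) (`zonalField`, `inner_zonalField`), and the theorem diagonalizes this Dirichlet form.

Green's formula on the sphere (`sphereForm_divergence`) and the Gegenbauer equation show that the
gradients of C_l(u·v) and C_m(w·v) pair to l(l+2α) times the L² pairing of the functions themselves.
Applying the formula on either side forces that pairing to vanish for l ≠ m. For l = m it equals the
mass of the sphere times α/(l+α) · C_l(u·w), because both sides obey the same recurrence in l
(`IsZonalForm.gegenbauerPoly_self`). These steps use only the divergence identities, abstracted as
`IsZonalForm`; Gaussian integration by parts in polar coordinates supplies them for the sphere.

The analytic part is that the gradient field of f has the L² expansion ∑ b_l ∇C_l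
(`hasSum_toLp_zonalField`). Polynomial fields are dense, and the coefficients come from integrating
the weak derivative by parts against the weight. Three weights meet here: orthogonality of the C_l
has exponent α - 1/2, gradients have α + 1/2, and the hypotheses have α. Cauchy–Schwarz passes from
L² at α to L¹ at α - 1/2, which suffices for the coefficients, and L² at α embeds in L² at α + 1/2.
Pairing the expansions at u₁ and u₂ gives the series. -/

@[simp] theorem gegenbauerPoly_zero : gegenbauerPoly α 0 = 1 := by rw [gegenbauerPoly]

@[simp] theorem gegenbauerPoly_one : gegenbauerPoly α 1 = C (2 * α) * X := by rw [gegenbauerPoly]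

theorem gegenbauerPoly_recurrence (n : ℕ) :
    C ((n : ℝ) + 2) * gegenbauerPoly α (n + 2) =
      C (2 * ((n : ℝ) + 1 + α)) * X * gegenbauerPoly α (n + 1)
        - C ((n : ℝ) + 2 * α) * gegenbauerPoly α n := by
  have h : (n : ℝ) + 2 ≠ 0 := by positivity
  rw [gegenbauerPoly, ← mul_assoc, ← C_mul, mul_inv_cancel₀ h, C_1, one_mul]

/-- The two relations are proved together because the inductive step for each one needs the other:
the differentiated recurrence and the first relation give the second at the next index, and that in
turn gives the first. -/
theorem gegenbauerPoly_derivative_relations (n : ℕ) :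
    X * derivative (gegenbauerPoly α (n + 1)) - derivative (gegenbauerPoly α n) =
        C ((n : ℝ) + 1) * gegenbauerPoly α (n + 1) ∧
      derivative (gegenbauerPoly α (n + 1)) - X * derivative (gegenbauerPoly α n) =
        C ((n : ℝ) + 2 * α) * gegenbauerPoly α n := by
  induction n with
  | zero => simp [mul_comm]
  | succ n ih =>
    obtain ⟨ha, hb⟩ := ih
    have hr := gegenbauerPoly_recurrence α n
    have hd := congrArg derivative hr
    simp only [derivative_mul, derivative_C, derivative_X, derivative_sub, zero_mul, zero_add,
      mul_one] at hd
    have hn : C ((n : ℝ) + 2) ≠ 0 := by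
      rw [Ne, C_eq_zero]; positivity
    simp only [C_add, C_mul, map_natCast, map_one, map_ofNat, Nat.cast_add, Nat.cast_one,
      show n + 1 + 1 = n + 2 from rfl] at *
    set A := gegenbauerPoly α n
    set B := gegenbauerPoly α (n + 1)
    set D := gegenbauerPoly α (n + 2)
    have hb' : derivative D - X * derivative B = ((n : ℝ[X]) + 1 + 2 * C α) * B := by
      apply mul_left_cancel₀ hn
      linear_combination hd + (n + 2 * C α) * ha
    refine ⟨?_, hb'⟩
    linear_combination X * hb' - hb + X * ha - hr

theorem X_mul_derivative_gegenbauerPoly_succ (n : ℕ) :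
    X * derivative (gegenbauerPoly α (n + 1)) =
      derivative (gegenbauerPoly α n) + C ((n : ℝ) + 1) * gegenbauerPoly α (n + 1) := by
  linear_combination (gegenbauerPoly_derivative_relations α n).1

theorem one_sub_X_sq_mul_derivative_gegenbauerPoly_succ (n : ℕ) :
    (1 - X ^ 2) * derivative (gegenbauerPoly α (n + 1)) =
      C ((n : ℝ) + 2 * α) * gegenbauerPoly α n
        - C ((n : ℝ) + 1) * X * gegenbauerPoly α (n + 1) := by
  linear_combination (gegenbauerPoly_derivative_relations α n).2
    - X * (gegenbauerPoly_derivative_relations α n).1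

theorem derivative_gegenbauerPoly_add_two (n : ℕ) :
    derivative (gegenbauerPoly α (n + 2)) =
      C (2 * ((n : ℝ) + 1 + α)) * gegenbauerPoly α (n + 1) + derivative (gegenbauerPoly α n) := by
  have h1 := (gegenbauerPoly_derivative_relations α (n + 1)).2
  have h2 := (gegenbauerPoly_derivative_relations α n).1
  simp only [C_add, C_mul, map_natCast, map_one, map_ofNat, Nat.cast_add, Nat.cast_one] at *
  linear_combination h1 + h2

/-- The Gegenbauer differential equation. -/
theorem gegenbauerPoly_ode (n : ℕ) :
    (1 - X ^ 2) * derivative (derivative (gegenbauerPoly α n))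
        - C (2 * α + 1) * X * derivative (gegenbauerPoly α n) =
      - (C ((n : ℝ) * (n + 2 * α)) * gegenbauerPoly α n) := by
  cases n with
  | zero => simp
  | succ n =>
    -- Differentiating the first-order relation leaves a derivative of the lower polynomial, which
    -- `h2` eliminates.
    have h := congrArg derivative (one_sub_X_sq_mul_derivative_gegenbauerPoly_succ α n)
    have h2 := X_mul_derivative_gegenbauerPoly_succ α n
    simp only [derivative_mul, derivative_C, derivative_X, derivative_sub, zero_mul, zero_add,
      mul_one, derivative_one, derivative_X_pow] at h
    simp only [C_add, C_mul, map_natCast, map_one, map_ofNat, Nat.cast_add, Nat.cast_one] at *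
    push_cast at h
    simp only [pow_one] at h
    linear_combination h - (n + 2 * C α) * h2

theorem degree_gegenbauerPoly {α : ℝ} (hα : 0 < α) (n : ℕ) :
    (gegenbauerPoly α n).degree = n := by
  induction n using Nat.strong_induction_on with
  | _ n ih =>
    match n with
    | 0 => simp
    | 1 =>
      rw [gegenbauerPoly_one, degree_C_mul_X (by positivity)]; rfl
    | n + 2 =>
      have h0 : (n : ℝ) + 2 ≠ 0 := by positivity
      have h1 : (2 * ((n : ℝ) + 1 + α)) ≠ 0 := by positivity
      have hA : (C (2 * ((n : ℝ) + 1 + α)) * X * gegenbauerPoly α (n + 1)).degree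
          = ((n + 2 : ℕ) : WithBot ℕ) := by
        rw [degree_mul, degree_C_mul_X h1, ih (n + 1) (by omega)]
        norm_cast; ring_nf
      have hB : (C ((n : ℝ) + 2 * α) * gegenbauerPoly α n).degree < ((n + 2 : ℕ) : WithBot ℕ) := by
        rw [degree_C_mul (by positivity), ih n (by omega)]
        norm_cast; omega
      rw [gegenbauerPoly, degree_C_mul (inv_ne_zero h0), degree_sub_eq_left_of_degree_lt, hA]
      rwa [hA]

/-- Every polynomial is a combination of the derivatives of the Gegenbauer polynomials. -/
theorem span_derivative_gegenbauerPoly {α : ℝ} (hα : 0 < α) :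
    Submodule.span ℝ (Set.range fun n => derivative (gegenbauerPoly α n)) = ⊤ := by
  let S : Polynomial.Sequence ℝ := ⟨gegenbauerPoly α, degree_gegenbauerPoly hα⟩
  have hS : Submodule.span ℝ (Set.range (gegenbauerPoly α)) = ⊤ :=
    S.span fun i => (leadingCoeff_ne_zero.2 (S.ne_zero i)).isUnit
  -- Every real polynomial has an antiderivative, so the image of a spanning family under
  -- differentiation still spans.
  have hsurj : LinearMap.range (derivative : ℝ[X] →ₗ[ℝ] ℝ[X]) = ⊤ := by
    refine LinearMap.range_eq_top.2 fun p => ?_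
    induction p using Polynomial.induction_on' with
    | add p q hp hq =>
      obtain ⟨p', rfl⟩ := hp
      obtain ⟨q', rfl⟩ := hq
      exact ⟨p' + q', map_add _ _ _⟩
    | monomial n a =>
      refine ⟨monomial (n + 1) (a / (n + 1)), ?_⟩
      rw [derivative_monomial]
      simp only [Nat.cast_add, Nat.cast_one, Nat.add_sub_cancel]
      rw [div_mul_cancel₀ _ (by positivity)]
  rw [show (Set.range fun n => derivative (gegenbauerPoly α n)) =
    (derivative : ℝ[X] →ₗ[ℝ] ℝ[X]) '' Set.range (gegenbauerPoly α) from by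
      rw [← Set.range_comp]; rfl, Submodule.span_image, hS, Submodule.map_top, hsurj]

end GegenbauerPolynomials

/-! ### Algebraic consequences of the divergence identities. -/

section ZonalForms

variable {α s : ℝ}

/-- A bilinear form on polynomials that satisfies the same divergence identities as
`(p, q) ↦ ∫ p (u₁ ⬝ v) q (u₂ ⬝ v) dv` over the unit sphere of `ℝ ^ (2 α + 2)`,
where `s = u₁ ⬝ u₂`. -/
structure IsZonalForm (α s : ℝ) (E : ℝ[X] →ₗ[ℝ] ℝ[X] →ₗ[ℝ] ℝ) : Prop where
  divergence : ∀ p q,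
    E ((1 - X ^ 2) * derivative p - C (2 * α + 1) * X * p) q
      + (s * E p (derivative q) - E (X * p) (X * derivative q)) = 0
  divergence_right : ∀ p q,
    E p ((1 - X ^ 2) * derivative q - C (2 * α + 1) * X * q)
      + (s * E (derivative p) q - E (X * derivative p) (X * q)) = 0

variable {E : ℝ[X] →ₗ[ℝ] ℝ[X] →ₗ[ℝ] ℝ}

/-- Taking p = C_l' in the divergence identity makes its first term the left side of the Gegenbauer
equation, hence -l(l+2α) C_l. For the sphere this is Green's formula for an eigenfunction of the
Laplacian. -/
theorem IsZonalForm.derivative_gegenbauerPoly (hE : IsZonalForm α s E) (l : ℕ) (q : ℝ[X]) :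
    s * E (derivative (gegenbauerPoly α l)) (derivative q)
        - E (X * derivative (gegenbauerPoly α l)) (X * derivative q) =
      (l : ℝ) * (l + 2 * α) * E (gegenbauerPoly α l) q := by
  have h := hE.divergence (derivative (gegenbauerPoly α l)) q
  rw [gegenbauerPoly_ode, ← smul_eq_C_mul, map_neg, map_smul] at h
  simp only [LinearMap.neg_apply, LinearMap.smul_apply, smul_eq_mul] at h
  linarith

theorem IsZonalForm.derivative_gegenbauerPoly_right (hE : IsZonalForm α s E) (p : ℝ[X]) (l : ℕ) :
    s * E (derivative p) (derivative (gegenbauerPoly α l))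
        - E (X * derivative p) (X * derivative (gegenbauerPoly α l)) =
      (l : ℝ) * (l + 2 * α) * E p (gegenbauerPoly α l) := by
  have h := hE.divergence_right p (derivative (gegenbauerPoly α l))
  rw [gegenbauerPoly_ode, ← smul_eq_C_mul, map_neg, map_smul, smul_eq_mul] at h
  linarith

/-- One Dirichlet pairing is evaluated with the eigenvalue of l and with that of m; the eigenvalues
differ by (l-m)(l+m+2α) ≠ 0. -/
theorem IsZonalForm.gegenbauerPoly_of_ne (hE : IsZonalForm α s E) (hα : 0 < α) {l m : ℕ}
    (hlm : l ≠ m) : E (gegenbauerPoly α l) (gegenbauerPoly α m) = 0 := by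
  have h1 := hE.derivative_gegenbauerPoly l (gegenbauerPoly α m)
  have h2 := hE.derivative_gegenbauerPoly_right (gegenbauerPoly α l) m
  have h3 : ((l : ℝ) - m) * (l + m + 2 * α) * E (gegenbauerPoly α l) (gegenbauerPoly α m) = 0 := by
    linear_combination h2 - h1
  have h4 : (l : ℝ) - m ≠ 0 := sub_ne_zero.2 (by exact_mod_cast hlm)
  have h5 : (l : ℝ) + m + 2 * α ≠ 0 := by positivity
  simpa [h4, h5] using h3

/-- C_m' is a combination of C_k with k < m, all of them orthogonal to C_l. -/
theorem IsZonalForm.gegenbauerPoly_derivative_of_le (hE : IsZonalForm α s E) (hα : 0 < α)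
    {l m : ℕ} (hlm : m ≤ l) :
    E (gegenbauerPoly α l) (derivative (gegenbauerPoly α m)) = 0 := by
  induction m using Nat.strong_induction_on with
  | _ m ih =>
    match m with
    | 0 => simp
    | 1 =>
      have := hE.gegenbauerPoly_of_ne hα (l := l) (m := 0) (by omega)
      rw [gegenbauerPoly_zero] at this
      rw [gegenbauerPoly_one, derivative_C_mul, derivative_X, ← smul_eq_C_mul, map_smul, this,
        smul_zero]
    | m + 2 =>
      rw [derivative_gegenbauerPoly_add_two, map_add, ih m (by omega) (by omega), ← smul_eq_C_mul,
        map_smul, hE.gegenbauerPoly_of_ne hα (by omega)]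
      simp

theorem IsZonalForm.gegenbauerPoly_derivative_succ (hE : IsZonalForm α s E) (hα : 0 < α)
    (l : ℕ) :
    E (gegenbauerPoly α l) (derivative (gegenbauerPoly α (l + 1))) =
      2 * (l + α) * E (gegenbauerPoly α l) (gegenbauerPoly α l) := by
  cases l with
  | zero =>
    rw [zero_add, gegenbauerPoly_one, derivative_C_mul, derivative_X, ← smul_eq_C_mul, map_smul]
    simp
  | succ l =>
    rw [derivative_gegenbauerPoly_add_two, map_add,
      hE.gegenbauerPoly_derivative_of_le hα (by omega), ← smul_eq_C_mul, map_smul]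
    push_cast
    simp

/-- The divergence identity for the neighbours C_{l+1}, C_{l+2} reduces, by orthogonality and the
relations for X·C and X·C', to diagonal values only. -/
theorem IsZonalForm.gegenbauerPoly_self_recurrence (hE : IsZonalForm α s E) (hα : 0 < α)
    (l : ℕ) :
    ((l : ℝ) + 2) * (l + 2 + α) *
        E (gegenbauerPoly α (l + 2)) (gegenbauerPoly α (l + 2)) =
      2 * s * (l + 1 + α) ^ 2 * E (gegenbauerPoly α (l + 1)) (gegenbauerPoly α (l + 1))
        - (l + 2 * α) * (l + α) * E (gegenbauerPoly α l) (gegenbauerPoly α l) := by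
  set D : ℕ → ℝ := fun n => E (gegenbauerPoly α n) (gegenbauerPoly α n) with hD
  have hX : X * gegenbauerPoly α (l + 1) = (2 * ((l : ℝ) + 1 + α))⁻¹ •
      (((l : ℝ) + 2) • gegenbauerPoly α (l + 2) + ((l : ℝ) + 2 * α) • gegenbauerPoly α l) := by
    rw [eq_inv_smul_iff₀ (by positivity)]
    simp only [smul_eq_C_mul]
    linear_combination -gegenbauerPoly_recurrence α l
  have h20 := hE.gegenbauerPoly_of_ne hα (l := l) (m := l + 2) (by omega)
  have h02 := hE.gegenbauerPoly_of_ne hα (l := l + 2) (m := l) (by omega)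
  have h := hE.divergence (gegenbauerPoly α (l + 1)) (gegenbauerPoly α (l + 2))
  have e1 : (1 - X ^ 2) * derivative (gegenbauerPoly α (l + 1))
        - C (2 * α + 1) * X * gegenbauerPoly α (l + 1) =
      ((l : ℝ) + 2 * α) • gegenbauerPoly α l
        - ((l : ℝ) + 2 + 2 * α) • (X * gegenbauerPoly α (l + 1)) := by
    have := one_sub_X_sq_mul_derivative_gegenbauerPoly_succ α l
    simp only [smul_eq_C_mul, C_add, C_mul, map_natCast, map_one, map_ofNat] at *
    linear_combination this
  have e2 : E (X * gegenbauerPoly α (l + 1)) (X * derivative (gegenbauerPoly α (l + 2))) =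
      (2 * ((l : ℝ) + 1 + α))⁻¹ * (((l : ℝ) + 2) ^ 2 * D (l + 2)
        + (l + 2 * α) * (2 * (l + α)) * D l) := by
    have := X_mul_derivative_gegenbauerPoly_succ α (l + 1)
    rw [this, hX, ← smul_eq_C_mul]
    simp only [map_add, map_smul, LinearMap.add_apply, LinearMap.smul_apply, smul_eq_mul, h20,
      hE.gegenbauerPoly_derivative_succ hα,
      hE.gegenbauerPoly_derivative_of_le hα (show l + 1 ≤ l + 2 by omega)]
    push_cast
    simp only [hD]
    ring
  have e3 := hE.gegenbauerPoly_derivative_succ hα (l + 1)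
  rw [e1, e2, e3, hX] at h
  simp only [map_add, map_sub, map_smul, LinearMap.add_apply, LinearMap.sub_apply,
    LinearMap.smul_apply, smul_eq_mul, h20] at h
  change ((l : ℝ) + 2) * (l + 2 + α) * D (l + 2) =
    2 * s * (l + 1 + α) ^ 2 * D (l + 1) - (l + 2 * α) * (l + α) * D l
  change _ * 0 - ((l : ℝ) + 2 + 2 * α) * (_ * ((l + 2) * D (l + 2) + _ * 0)) +
    (s * (_ * D (l + 1)) - _) = 0 at h
  have hne : (l : ℝ) + 1 + α ≠ 0 := by positivity
  push_cast at h
  field_simp at h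
  linear_combination (-1 / 2) * h

/-- The values (l+α) E(C_l, C_l) satisfy the three-term recurrence of C_l(s), so they are fixed by l
= 0 and l = 1. This is a reproducing formula of Funk–Hecke type. -/
theorem IsZonalForm.gegenbauerPoly_self (hE : IsZonalForm α s E) (hα : 0 < α) (l : ℕ) :
    (l + α) * E (gegenbauerPoly α l) (gegenbauerPoly α l) =
      E 1 1 * (α * (gegenbauerPoly α l).eval s) := by
  induction l using Nat.strong_induction_on with
  | _ l ih =>
    match l with
    | 0 => simp [mul_comm]
    | 1 =>
      have h := hE.divergence 1 X
      simp only [derivative_one, mul_zero, zero_sub, mul_one, derivative_X, ← smul_eq_C_mul,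
        map_neg, map_smul, LinearMap.neg_apply, LinearMap.smul_apply, smul_eq_mul] at h
      simp only [gegenbauerPoly_one, ← smul_eq_C_mul, map_smul, LinearMap.smul_apply, smul_eq_mul,
        eval_smul, eval_X, Nat.cast_one]
      linear_combination (-2 * α ^ 2) * h
    | l + 2 =>
      have h := hE.gegenbauerPoly_self_recurrence hα l
      have h0 := ih l (by omega)
      have h1 := ih (l + 1) (by omega)
      have hr := congrArg (eval s) (gegenbauerPoly_recurrence α l)
      simp only [eval_mul, eval_sub, eval_C, eval_X] at hr
      have hne : (l : ℝ) + 2 ≠ 0 := by positivity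
      apply mul_left_cancel₀ hne
      push_cast at *
      linear_combination h + 2 * s * (l + 1 + α) * h1 - (l + 2 * α) * h0 - E 1 1 * α * hr

end ZonalForms

/-! ### Gaussian integrals: integration by parts and polar coordinates. -/

section GaussianMoments

open Measure Set

variable {V : Type*} [NormedAddCommGroup V] [InnerProductSpace ℝ V] [FiniteDimensional ℝ V]
  [MeasurableSpace V] [BorelSpace V]

theorem integrable_norm_pow_mul_exp_neg_sq [Nontrivial V] (n : ℕ) :
    Integrable (fun x : V => ‖x‖ ^ n * Real.exp (-(1 / 2) * ‖x‖ ^ 2)) := by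
  rw [integrable_fun_norm_addHaar (volume : Measure V)
    (f := fun r => r ^ n * Real.exp (-(1 / 2) * r ^ 2))]
  have h := integrableOn_rpow_mul_exp_neg_mul_sq (b := 1 / 2) (by norm_num)
    (s := ((Module.finrank ℝ V - 1 + n : ℕ) : ℝ))
    (lt_of_lt_of_le (by norm_num) (Nat.cast_nonneg _))
  refine h.congr_fun (fun r _ => ?_) measurableSet_Ioi
  simp only [Real.rpow_natCast, smul_eq_mul, pow_add]
  ring

theorem integrable_inner_pow_mul_exp_neg_sq [Nontrivial V] (u w : V) (k j : ℕ) :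
    Integrable (fun x : V =>
      inner ℝ u x ^ k * inner ℝ w x ^ j * Real.exp (-(1 / 2) * ‖x‖ ^ 2)) := by
  refine ((integrable_norm_pow_mul_exp_neg_sq (V := V) (k + j)).const_mul
    (‖u‖ ^ k * ‖w‖ ^ j)).mono' (by fun_prop) (Eventually.of_forall fun x => ?_)
  rw [norm_mul, norm_mul, norm_pow, norm_pow, Real.norm_of_nonneg (Real.exp_pos _).le]
  calc ‖inner ℝ u x‖ ^ k * ‖inner ℝ w x‖ ^ j * Real.exp (-(1 / 2) * ‖x‖ ^ 2)
      ≤ (‖u‖ * ‖x‖) ^ k * (‖w‖ * ‖x‖) ^ j * Real.exp (-(1 / 2) * ‖x‖ ^ 2) := by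
        gcongr <;> exact norm_inner_le_norm _ _
    _ = _ := by rw [mul_pow, mul_pow, pow_add]; ring

/-- Gaussian integration by parts for products of powers of two linear forms. -/
theorem integral_inner_pow_succ_mul_exp_neg_sq [Nontrivial V] (u w : V) (k j : ℕ) :
    ∫ x : V, inner ℝ u x ^ (k + 1) * inner ℝ w x ^ j * Real.exp (-(1 / 2) * ‖x‖ ^ 2) =
      k * inner ℝ u u *
          (∫ x : V, inner ℝ u x ^ (k - 1) * inner ℝ w x ^ j * Real.exp (-(1 / 2) * ‖x‖ ^ 2))
        + j * inner ℝ u w *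
          ∫ x : V, inner ℝ u x ^ k * inner ℝ w x ^ (j - 1) * Real.exp (-(1 / 2) * ‖x‖ ^ 2) := by
  have hI := fun k j => integrable_inner_pow_mul_exp_neg_sq u w k j
  have hF : ∀ x : V, HasFDerivAt (fun x : V => inner ℝ u x ^ k * inner ℝ w x ^ j)
      ((inner ℝ u x ^ k) • ((j * inner ℝ w x ^ (j - 1)) • innerSL ℝ w)
        + (inner ℝ w x ^ j) • ((k * inner ℝ u x ^ (k - 1)) • innerSL ℝ u)) x := fun x => by
    have h := (((innerSL ℝ u).hasFDerivAt (x := x)).pow k).mul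
      (((innerSL ℝ w).hasFDerivAt (x := x)).pow j)
    simp only [nsmul_eq_mul, innerSL_apply_apply] at h
    exact h
  have hG : ∀ x : V, HasFDerivAt (fun x : V => Real.exp (-(1 / 2) * ‖x‖ ^ 2))
      (Real.exp (-(1 / 2) * ‖x‖ ^ 2) • ((-(1 / 2) : ℝ) • (2 • innerSL ℝ x))) x := fun x =>
    ((hasStrictFDerivAt_norm_sq x).hasFDerivAt.const_mul (-(1 / 2) : ℝ)).exp
  -- Integration by parts in the direction u: the derivative of the Gaussian produces the extra
  -- factor u·x.
  have h := integral_bilinear_hasFDerivAt_right_eq_neg_left_of_integrable (μ := (volume : Measure V))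
    (v := u) (B := ContinuousLinearMap.mul ℝ ℝ)
    (f := fun x : V => inner ℝ u x ^ k * inner ℝ w x ^ j)
    (g := fun x : V => Real.exp (-(1 / 2) * ‖x‖ ^ 2)) (f' := _) (g' := _) ?_ ?_ ?_
    (fun x _ => hF x) (fun x _ => hG x)
  · simp only [ContinuousLinearMap.mul_apply', _root_.add_apply,
      _root_.smul_apply, innerSL_apply_apply, smul_eq_mul, nsmul_eq_mul] at h
    rw [← integral_const_mul (k * inner ℝ u u), ← integral_const_mul (j * inner ℝ u w),
      ← integral_add ((hI _ _).const_mul _)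
      ((hI _ _).const_mul _)]
    rw [← neg_eq_iff_eq_neg, ← integral_neg] at h
    convert h using 1
    · refine integral_congr_ae (Eventually.of_forall fun x => ?_)
      simp only [Nat.cast_ofNat, real_inner_comm u x]
      ring
    · refine integral_congr_ae (Eventually.of_forall fun x => ?_)
      simp only [real_inner_comm u w]
      ring
  · refine (((hI k (j - 1)).const_mul (j * inner ℝ w u)).add
      ((hI (k - 1) j).const_mul (k * inner ℝ u u))).congr (Eventually.of_forall fun x => ?_)
    simp
    ring
  · refine ((hI (k + 1) j).const_mul (-1)).congr (Eventually.of_forall fun x => ?_)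
    simp [real_inner_comm u x]
    ring
  · exact hI k j

/-- The radial integral `∫ r ^ n exp (- r ^ 2 / 2) r ^ (m - 1) dr`. -/
noncomputable def gaussianRadialMoment (m n : ℕ) : ℝ :=
  ∫ r : Ioi (0 : ℝ), r.1 ^ n * Real.exp (-(1 / 2) * r.1 ^ 2) ∂(volumeIoiPow (m - 1))

theorem gaussianRadialMoment_eq {m : ℕ} (hm : 0 < m) (n : ℕ) :
    gaussianRadialMoment m n =
      (1 / 2 : ℝ) ^ (-((n + m : ℝ) / 2)) * (1 / 2) * Real.Gamma ((n + m : ℝ) / 2) := by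
  have h := integral_rpow_mul_exp_neg_mul_rpow (p := 2) (q := (n + m : ℝ) - 1) (b := 1 / 2)
    (by norm_num) (by have : (0 : ℝ) < m := by exact_mod_cast hm
                      have : (0 : ℝ) ≤ n := n.cast_nonneg
                      linarith) (by norm_num)
  rw [sub_add_cancel, neg_div _ (n + m : ℝ)] at h
  rw [← h, gaussianRadialMoment]
  simp only [Measure.volumeIoiPow, ENNReal.ofReal]
  rw [integral_withDensity_eq_integral_smul
      ((measurable_subtype_coe.pow_const _).real_toNNReal),
    integral_subtype_comap measurableSet_Ioi fun a : ℝ =>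
      Real.toNNReal (a ^ (m - 1)) • (a ^ n * Real.exp (-(1 / 2) * a ^ 2))]
  refine setIntegral_congr_fun measurableSet_Ioi fun x hx => ?_
  have hx0 : (0 : ℝ) < x := hx
  rw [NNReal.smul_def, Real.coe_toNNReal _ (pow_nonneg hx0.le _),
    show (n + m : ℝ) - 1 = ((m - 1 + n : ℕ) : ℝ) by push_cast [Nat.cast_pred hm]; ring,
    Real.rpow_natCast, smul_eq_mul, pow_add, mul_assoc]
  norm_num

theorem gaussianRadialMoment_pos {m : ℕ} (hm : 0 < m) (n : ℕ) :
    0 < gaussianRadialMoment m n := by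
  rw [gaussianRadialMoment_eq hm]
  have : 0 < Real.Gamma ((n + m : ℝ) / 2) := Real.Gamma_pos_of_pos (by positivity)
  positivity

theorem gaussianRadialMoment_add_two {m : ℕ} (hm : 0 < m) (n : ℕ) :
    gaussianRadialMoment m (n + 2) = (n + m) * gaussianRadialMoment m n := by
  rw [gaussianRadialMoment_eq hm, gaussianRadialMoment_eq hm]
  have h0 : (n + m : ℝ) / 2 ≠ 0 := by positivity
  rw [show (((n + 2 : ℕ) : ℝ) + m) / 2 = (n + m : ℝ) / 2 + 1 by push_cast; ring,
    Real.Gamma_add_one h0, neg_add, Real.rpow_add (by norm_num), Real.rpow_neg_one]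
  ring

/-- Polar coordinates for the Gaussian integral of a homogeneous function. -/
theorem integral_homogeneous_mul_exp_neg_sq [Nontrivial V] {F : V → ℝ} {n : ℕ}
    (hF : ∀ (r : ℝ) (x : V), F (r • x) = r ^ n * F x) :
    ∫ x : V, F x * Real.exp (-(1 / 2) * ‖x‖ ^ 2) =
      gaussianRadialMoment (Module.finrank ℝ V) n *
        ∫ v : Metric.sphere (0 : V) 1, F v ∂(volume : Measure V).toSphere := by
  rw [mul_comm, gaussianRadialMoment, ← integral_prod_mul (fun v : Metric.sphere (0 : V) 1 => F v)
    (fun r : Ioi (0 : ℝ) => r.1 ^ n * Real.exp (-(1 / 2) * r.1 ^ 2))]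
  have hm : MeasurePreserving (homeomorphUnitSphereProd V) ((volume : Measure V).comap (↑))
    ((volume : Measure V).toSphere.prod (volumeIoiPow (Module.finrank ℝ V - 1))) :=
    measurePreserving_homeomorphUnitSphereProd _
  have h := hm.integral_comp (Homeomorph.measurableEmbedding _)
    (fun z : Metric.sphere (0 : V) 1 × Ioi (0 : ℝ) =>
      F z.1 * (z.2.1 ^ n * Real.exp (-(1 / 2) * z.2.1 ^ 2)))
  rw [← h]
  conv_lhs => rw [← restrict_compl_singleton (μ := (volume : Measure V)) 0,
    ← integral_subtype_comap (measurableSet_singleton _).compl]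
  refine integral_congr_ae (Eventually.of_forall fun x => ?_)
  have hx : ‖x.1‖ ≠ 0 := norm_ne_zero_iff.2 x.2
  simp only [homeomorphUnitSphereProd_apply_fst_coe, homeomorphUnitSphereProd_apply_snd_coe]
  rw [hF, inv_pow]
  field_simp

end GaussianMoments

/-! ### Polynomial integrals over the sphere and the divergence identity. -/

section SphereIntegrals

open Measure

variable {V : Type*} [NormedAddCommGroup V] [InnerProductSpace ℝ V] [FiniteDimensional ℝ V]
  [MeasurableSpace V] [BorelSpace V]

/-- This is the Gaussian identity with its radial factor divided out. The left side has degree two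
more than the right, and the resulting ratio of radial moments is the constant in front. -/
theorem integral_sphere_inner_pow_succ [Nontrivial V] (u w : V) (k j : ℕ) :
    ((k : ℝ) + j + Module.finrank ℝ V - 1) *
        ∫ v : Metric.sphere (0 : V) 1, inner ℝ u v.1 ^ (k + 1) * inner ℝ w v.1 ^ j
          ∂(volume : Measure V).toSphere =
      k * inner ℝ u u * ∫ v : Metric.sphere (0 : V) 1,
          inner ℝ u v.1 ^ (k - 1) * inner ℝ w v.1 ^ j ∂(volume : Measure V).toSphere
        + j * inner ℝ u w * ∫ v : Metric.sphere (0 : V) 1,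
          inner ℝ u v.1 ^ k * inner ℝ w v.1 ^ (j - 1) ∂(volume : Measure V).toSphere := by
  have hd : 0 < Module.finrank ℝ V := Module.finrank_pos
  have hom : ∀ k j : ℕ, ∀ (r : ℝ) (x : V),
      inner ℝ u (r • x) ^ k * inner ℝ w (r • x) ^ j =
        r ^ (k + j) * (inner ℝ u x ^ k * inner ℝ w x ^ j) := fun k j r x => by
    rw [inner_smul_right, inner_smul_right, mul_pow, mul_pow, pow_add]; ring
  have hN := fun k j => integral_homogeneous_mul_exp_neg_sq
    (F := fun x : V => inner ℝ u x ^ k * inner ℝ w x ^ j) (hom k j)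
  have h := integral_inner_pow_succ_mul_exp_neg_sq u w k j
  rw [hN (k + 1) j, hN (k - 1) j, hN k (j - 1)] at h
  -- In degree zero there is no radial moment two degrees lower; the identity then only says that
  -- u·v has integral zero.
  rcases Nat.eq_zero_or_pos (k + j) with h0 | h0
  · obtain ⟨rfl, rfl⟩ : k = 0 ∧ j = 0 := by omega
    have hR := (gaussianRadialMoment_pos hd 1).ne'
    simp [hR] at h
    simp [h]
  · obtain ⟨n, hn⟩ : ∃ n, k + j = n + 1 := ⟨k + j - 1, by omega⟩
    have hR := (gaussianRadialMoment_pos hd n).ne'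
    have hn' : (k : ℝ) + j = n + 1 := by exact_mod_cast hn
    rw [show k + 1 + j = n + 2 by omega, gaussianRadialMoment_add_two hd] at h
    apply mul_left_cancel₀ hR
    rw [hn']
    -- For k = 0 the truncated k - 1 gives the wrong degree, but the factor k kills the term; `e2`
    -- treats j in the same way.
    have e1 : (k : ℝ) * gaussianRadialMoment (Module.finrank ℝ V) (k - 1 + j) =
        k * gaussianRadialMoment (Module.finrank ℝ V) n := by
      rcases k.eq_zero_or_pos with rfl | hk
      · simp
      · rw [show k - 1 + j = n by omega]
    have e2 : (j : ℝ) * gaussianRadialMoment (Module.finrank ℝ V) (k + (j - 1)) =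
        j * gaussianRadialMoment (Module.finrank ℝ V) n := by
      rcases j.eq_zero_or_pos with rfl | hj
      · simp
      · rw [show k + (j - 1) = n by omega]
    linear_combination h + e1 * inner ℝ u u * (∫ v : Metric.sphere (0 : V) 1,
          inner ℝ u v.1 ^ (k - 1) * inner ℝ w v.1 ^ j ∂(volume : Measure V).toSphere) +
      e2 * inner ℝ u w * ∫ v : Metric.sphere (0 : V) 1,
          inner ℝ u v.1 ^ k * inner ℝ w v.1 ^ (j - 1) ∂(volume : Measure V).toSphere

theorem Continuous.integrable_toSphere {F : Type*} [NormedAddCommGroup F]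
    {f : Metric.sphere (0 : V) 1 → F} (hf : Continuous f) :
    Integrable f (volume : Measure V).toSphere :=
  hf.integrable_of_hasCompactSupport (HasCompactSupport.of_compactSpace f)

/-- The bilinear form `(p, q) ↦ ∫ p (u ⬝ v) q (w ⬝ v) dv` over the unit sphere. -/
noncomputable def sphereForm (u w : V) : ℝ[X] →ₗ[ℝ] ℝ[X] →ₗ[ℝ] ℝ :=
  LinearMap.mk₂ ℝ
    (fun p q => ∫ v : Metric.sphere (0 : V) 1,
      p.eval (inner ℝ u v.1) * q.eval (inner ℝ w v.1) ∂(volume : Measure V).toSphere)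
    (fun p p' q => by
      rw [← integral_add (Continuous.integrable_toSphere (by fun_prop))
        (Continuous.integrable_toSphere (by fun_prop))]
      simp only [eval_add, add_mul])
    (fun c p q => by
      rw [smul_eq_mul, ← integral_const_mul]
      simp only [eval_smul, smul_eq_mul, mul_assoc])
    (fun p q q' => by
      rw [← integral_add (Continuous.integrable_toSphere (by fun_prop))
        (Continuous.integrable_toSphere (by fun_prop))]
      simp only [eval_add, mul_add])
    (fun c p q => by
      rw [smul_eq_mul, ← integral_const_mul]
      simp only [eval_smul, smul_eq_mul, mul_left_comm])

theorem sphereForm_apply (u w : V) (p q : ℝ[X]) :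
    sphereForm u w p q = ∫ v : Metric.sphere (0 : V) 1,
      p.eval (inner ℝ u v.1) * q.eval (inner ℝ w v.1) ∂(volume : Measure V).toSphere := rfl

theorem sphereForm_comm (u w : V) (p q : ℝ[X]) : sphereForm u w p q = sphereForm w u q p := by
  simp only [sphereForm_apply, mul_comm]

/-- This is the divergence theorem for the tangential field p(u·v) q(w·v) (u - (u·v) v), with 2α + 1
the dimension of the sphere. By bilinearity it suffices to take monomials, where it becomes the
recursion for sphere moments. -/
theorem sphereForm_divergence [Nontrivial V] {α : ℝ} (hα : 2 * α + 2 = Module.finrank ℝ V)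
    {u : V} (hu : ‖u‖ = 1) (w : V) (p q : ℝ[X]) :
    sphereForm u w ((1 - X ^ 2) * derivative p - C (2 * α + 1) * X * p) q
      + (inner ℝ u w * sphereForm u w p (derivative q)
        - sphereForm u w (X * p) (X * derivative q)) = 0 := by
  -- The constant is hidden so that `map_add` does not split it.
  obtain ⟨c, hc⟩ : ∃ c : ℝ[X], C (2 * α + 1) = c := ⟨_, rfl⟩
  rw [hc]
  induction p using Polynomial.induction_on' with
  | add p p' hp hp' =>
    simp only [mul_add, map_add, add_sub_add_comm, LinearMap.add_apply]
    linear_combination hp + hp'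
  | monomial k a =>
  induction q using Polynomial.induction_on' with
  | add q q' hq hq' =>
    simp only [mul_add, map_add]
    linear_combination hq + hq'
  | monomial j b =>
    have h := integral_sphere_inner_pow_succ u w k j
    have e : ∀ k j, ∫ v : Metric.sphere (0 : V) 1, inner ℝ u v.1 ^ k * inner ℝ w v.1 ^ j
          ∂(volume : Measure V).toSphere = sphereForm u w (X ^ k) (X ^ j) := fun k j => by
      simp [sphereForm_apply]
    rw [e, e, e, real_inner_self_eq_norm_sq, hu] at h
    have eX : X * derivative ((X : ℝ[X]) ^ j) = (j : ℝ) • X ^ j := by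
      cases j with
      | zero => simp
      | succ j =>
        rw [derivative_X_pow, smul_eq_C_mul, Nat.add_sub_cancel]; ring
    subst hc
    have eY : (1 - X ^ 2) * derivative ((X : ℝ[X]) ^ k) - C (2 * α + 1) * X * X ^ k =
        (k : ℝ) • X ^ (k - 1) - (k + 2 * α + 1) • X ^ (k + 1) := by
      cases k with
      | zero => simp [smul_eq_C_mul]
      | succ k =>
        rw [derivative_X_pow, smul_eq_C_mul, smul_eq_C_mul, Nat.add_sub_cancel]
        simp only [C_add, map_natCast]
        push_cast; ring
    have key : sphereForm u w ((1 - X ^ 2) * derivative (X ^ k) - C (2 * α + 1) * X * X ^ k) (X ^ j)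
      + (inner ℝ u w * sphereForm u w (X ^ k) (derivative (X ^ j))
        - sphereForm u w (X * X ^ k) (X * derivative (X ^ j))) = 0 := by
      rw [eX, eY, ← pow_succ', derivative_X_pow, ← smul_eq_C_mul]
      simp only [map_sub, map_smul, LinearMap.sub_apply, LinearMap.smul_apply, smul_eq_mul]
      linear_combination -h + sphereForm u w (X ^ (k + 1)) (X ^ j) * (-hα)
    rw [← C_mul_X_pow_eq_monomial, ← C_mul_X_pow_eq_monomial,
      show (1 - X ^ 2) * derivative (C a * X ^ k) - C (2 * α + 1) * X * (C a * X ^ k) =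
        a • ((1 - X ^ 2) * derivative (X ^ k) - C (2 * α + 1) * X * X ^ k) by
          rw [derivative_C_mul, smul_eq_C_mul]; ring,
      show X * (C a * X ^ k) = a • (X * X ^ k) by rw [smul_eq_C_mul]; ring,
      show derivative (C b * X ^ j) = b • derivative (X ^ j) by
        rw [derivative_C_mul, smul_eq_C_mul],
      show X * (b • derivative (X ^ j)) = b • (X * derivative (X ^ j)) by
        rw [smul_eq_C_mul, smul_eq_C_mul]; ring,
      ← smul_eq_C_mul b, ← smul_eq_C_mul a]
    simp only [map_smul, LinearMap.smul_apply, smul_eq_mul]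
    linear_combination a * b * key

end SphereIntegrals

/-! ### The weighted measures on the interval. -/

section GegenbauerMeasure

open Set

theorem one_sub_sq_pos {x : ℝ} (hx : x ∈ Ioo (-1 : ℝ) 1) : 0 < 1 - x ^ 2 := by
  nlinarith [hx.1, hx.2]

theorem one_sub_sq_le_one (x : ℝ) : 1 - x ^ 2 ≤ 1 := by nlinarith [sq_nonneg x]

theorem measurable_gegenbauerDensity (β : ℝ) :
    Measurable fun x : ℝ => ENNReal.ofReal ((1 - x ^ 2) ^ β) := by fun_prop

theorem integrable_gegenbauerMeasure_iff {β : ℝ} {f : ℝ → ℝ} :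
    Integrable f (gegenbauerMeasure β) ↔
      IntegrableOn (fun x => (1 - x ^ 2) ^ β * f x) (Ioo (-1) 1) := by
  rw [gegenbauerMeasure, integrable_withDensity_iff_integrable_smul' (measurable_gegenbauerDensity β)
    (by simp)]
  refine integrableOn_congr_fun (fun x hx => ?_) measurableSet_Ioo
  rw [ENNReal.toReal_ofReal (Real.rpow_nonneg (one_sub_sq_pos hx).le _), smul_eq_mul]

theorem integral_gegenbauerMeasure (β : ℝ) (f : ℝ → ℝ) :
    ∫ x, f x ∂(gegenbauerMeasure β) = ∫ x in Ioo (-1 : ℝ) 1, (1 - x ^ 2) ^ β * f x := by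
  rw [gegenbauerMeasure, integral_withDensity_eq_integral_toReal_smul
    (measurable_gegenbauerDensity β) (by simp)]
  refine setIntegral_congr_fun measurableSet_Ioo (fun x hx => ?_)
  rw [ENNReal.toReal_ofReal (Real.rpow_nonneg (one_sub_sq_pos hx).le _), smul_eq_mul]

theorem gegenbauerMeasure_absolutelyContinuous (β : ℝ) :
    gegenbauerMeasure β ≪ volume.restrict (Ioo (-1 : ℝ) 1) :=
  withDensity_absolutelyContinuous _ _

theorem absolutelyContinuous_gegenbauerMeasure (β : ℝ) :
    volume.restrict (Ioo (-1 : ℝ) 1) ≪ gegenbauerMeasure β := by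
  refine withDensity_absolutelyContinuous' (measurable_gegenbauerDensity β).aemeasurable ?_
  filter_upwards [ae_restrict_mem measurableSet_Ioo] with x hx
  simpa using Real.rpow_pos_of_pos (one_sub_sq_pos hx) β

theorem ae_mem_Ioo_gegenbauerMeasure (β : ℝ) :
    ∀ᵐ x ∂(gegenbauerMeasure β), x ∈ Ioo (-1 : ℝ) 1 :=
  (gegenbauerMeasure_absolutelyContinuous β).ae_le (ae_restrict_mem measurableSet_Ioo)

/-- At the extreme exponent -1/2 the function is the derivative of arcsin; larger exponents give
smaller functions because 1 - x² ≤ 1. -/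
theorem integrableOn_one_sub_sq_rpow {β : ℝ} (hβ : -(1 / 2) ≤ β) :
    IntegrableOn (fun x : ℝ => (1 - x ^ 2) ^ β) (Ioo (-1) 1) := by
  have h : IntegrableOn (fun x : ℝ => 1 / √(1 - x ^ 2)) (Ioo (-1) 1) :=
    (intervalIntegral.integrableOn_deriv_of_nonneg Real.continuous_arcsin.continuousOn
      (fun x hx => Real.hasDerivAt_arcsin hx.1.ne' hx.2.ne)
      (fun x _ => by positivity)).mono_set Ioo_subset_Ioc_self
  refine h.mono' (Measurable.aestronglyMeasurable (by fun_prop)) ?_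
  filter_upwards [ae_restrict_mem measurableSet_Ioo] with x hx
  rw [Real.norm_of_nonneg (Real.rpow_nonneg (one_sub_sq_pos hx).le _), Real.sqrt_eq_rpow,
    one_div, ← Real.rpow_neg (one_sub_sq_pos hx).le]
  exact Real.rpow_le_rpow_of_exponent_ge (one_sub_sq_pos hx) (one_sub_sq_le_one x) hβ

theorem isFiniteMeasure_gegenbauerMeasure {β : ℝ} (hβ : -(1 / 2) ≤ β) :
    IsFiniteMeasure (gegenbauerMeasure β) := by
  have : Integrable (fun _ : ℝ => (1 : ℝ)) (gegenbauerMeasure β) := by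
    rw [integrable_gegenbauerMeasure_iff]
    simpa using integrableOn_one_sub_sq_rpow hβ
  simpa [integrable_const_iff] using this

theorem gegenbauerMeasure_ne_zero (β : ℝ) : gegenbauerMeasure β ≠ 0 := fun h => by
  have := absolutelyContinuous_gegenbauerMeasure β (s := univ) (by simp [h])
  norm_num at this

theorem exists_norm_eval_le (p : ℝ[X]) :
    ∃ K : ℝ, 0 ≤ K ∧ ∀ x ∈ Icc (-1 : ℝ) 1, ‖p.eval x‖ ≤ K := by
  obtain ⟨K, hK⟩ := isCompact_Icc.exists_bound_of_continuousOn (s := Icc (-1 : ℝ) 1)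
    p.continuous.continuousOn
  exact ⟨max K 0, le_max_right _ _, fun x hx => (hK x hx).trans (le_max_left _ _)⟩

theorem memLp_eval_gegenbauerMeasure {β : ℝ} (hβ : -(1 / 2) ≤ β) (p : ℝ[X]) (q : ℝ≥0∞) :
    MemLp (fun x => p.eval x) q (gegenbauerMeasure β) := by
  have := isFiniteMeasure_gegenbauerMeasure hβ
  obtain ⟨K, -, hK⟩ := exists_norm_eval_le p
  refine MemLp.of_bound p.continuous.aestronglyMeasurable K ?_
  filter_upwards [ae_mem_Ioo_gegenbauerMeasure β] with x hx
  exact hK x (Ioo_subset_Icc_self hx)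

/-- Divergence identity for polynomials on the interval. -/
theorem integral_gegenbauerMeasure_divergence {β : ℝ} (hβ : -(1 / 2) ≤ β) (p : ℝ[X]) :
    ∫ x, ((1 - X ^ 2) * derivative p - C (2 * (β + 1)) * X * p).eval x
      ∂(gegenbauerMeasure β) = 0 := by
  rw [integral_gegenbauerMeasure, ← integral_Ioc_eq_integral_Ioo,
    ← intervalIntegral.integral_of_le (by norm_num)]
  have h := intervalIntegral.integral_eq_sub_of_hasDerivAt_of_le (a := -1) (b := 1) (by norm_num)
    (f := fun x => (1 - x ^ 2) ^ (β + 1) * p.eval x)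
    (f' := fun x => (1 - x ^ 2) ^ β *
      ((1 - X ^ 2) * derivative p - C (2 * (β + 1)) * X * p).eval x) ?_ ?_ ?_
  · rw [h]
    norm_num
    rw [Real.zero_rpow (by linarith)]
    simp
  · refine ContinuousOn.mul ?_ p.continuous.continuousOn
    exact (Continuous.rpow_const (by fun_prop) fun _ => Or.inr (by linarith)).continuousOn
  · intro x hx
    have hw := one_sub_sq_pos hx
    have h1 : HasDerivAt (fun x : ℝ => 1 - x ^ 2) (-(2 * x)) x := by
      simpa using (hasDerivAt_pow 2 x).const_sub 1
    have h2 := (h1.rpow_const (p := β + 1) (Or.inl hw.ne')).mul (p.hasDerivAt x)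
    refine h2.congr_deriv ?_
    rw [add_sub_cancel_right, Real.rpow_add_one hw.ne']
    simp
    ring
  · rw [intervalIntegrable_iff_integrableOn_Ioo_of_le (by norm_num)]
    exact integrable_gegenbauerMeasure_iff.1
      (memLp_one_iff_integrable.1 (memLp_eval_gegenbauerMeasure hβ _ 1))

end GegenbauerMeasure

/-! ### Measures on [-1, 1] determined by polynomial integrals. -/

section MomentDeterminacy

open Set

theorem integrable_eval_of_ae_mem_Icc {μ : Measure ℝ} [IsFiniteMeasure μ]
    (hμ : ∀ᵐ x ∂μ, x ∈ Icc (-1 : ℝ) 1) (p : ℝ[X]) : Integrable (fun x => p.eval x) μ := by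
  obtain ⟨K, -, hK⟩ := exists_norm_eval_le p
  refine Integrable.of_bound p.continuous.aestronglyMeasurable K ?_
  filter_upwards [hμ] with x hx using hK x hx

/-- Two finite measures on `[-1, 1]` that give the same integral to every polynomial are equal. -/
theorem Measure.ext_of_forall_integral_eval {μ ν : Measure ℝ} [IsFiniteMeasure μ]
    [IsFiniteMeasure ν] (hμ : ∀ᵐ x ∂μ, x ∈ Icc (-1 : ℝ) 1) (hν : ∀ᵐ x ∂ν, x ∈ Icc (-1 : ℝ) 1)
    (h : ∀ p : ℝ[X], ∫ x, p.eval x ∂μ = ∫ x, p.eval x ∂ν) : μ = ν := by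
  refine ext_of_forall_integral_eq_of_IsFiniteMeasure fun f => ?_
  have key : ∀ (ρ : Measure ℝ) [IsFiniteMeasure ρ], (∀ᵐ x ∂ρ, x ∈ Icc (-1 : ℝ) 1) →
      ∀ (ε : ℝ) (p : ℝ[X]), (∀ x ∈ Icc (-1 : ℝ) 1, |p.eval x - f x| < ε) →
        |∫ x, p.eval x ∂ρ - ∫ x, f x ∂ρ| ≤ ε * ρ.real univ := by
    intro ρ _ hρ ε p hp
    rw [← integral_sub (integrable_eval_of_ae_mem_Icc hρ p) (f.integrable ρ)]
    rw [← Real.norm_eq_abs]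
    refine norm_integral_le_of_norm_le_const (μ := ρ) (C := ε) ?_
    filter_upwards [hρ] with x hx using (hp x hx).le
  refine eq_of_forall_dist_le fun ε hε => ?_
  have hM : 0 < μ.real univ + ν.real univ + 1 := by positivity
  obtain ⟨p, hp⟩ := exists_polynomial_near_of_continuousOn (-1) 1 f f.continuous.continuousOn
    (ε / (μ.real univ + ν.real univ + 1)) (by positivity)
  have h1 := abs_le.1 (key μ hμ _ p hp)
  have h2 := abs_le.1 (key ν hν _ p hp)
  have h3 : ε / (μ.real univ + ν.real univ + 1) * (μ.real univ + ν.real univ) ≤ ε := by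
    rw [div_mul_eq_mul_div, div_le_iff₀ hM]
    nlinarith
  rw [h p] at h1
  rw [Real.dist_eq, abs_le]
  constructor <;> linarith [h1.1, h1.2, h2.1, h2.2]

/-- On X^k the identity expresses the moment of order k + 1 by that of order k - 1, so the total
mass determines all moments. -/
theorem linearMap_eq_of_divergence {γ : ℝ} (hγ : 0 < γ) {L L' : ℝ[X] →ₗ[ℝ] ℝ}
    (hL : ∀ p, L ((1 - X ^ 2) * derivative p - C γ * X * p) = 0)
    (hL' : ∀ p, L' ((1 - X ^ 2) * derivative p - C γ * X * p) = 0) (h1 : L 1 = L' 1) :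
    L = L' := by
  have key : ∀ (M : ℝ[X] →ₗ[ℝ] ℝ), (∀ p, M ((1 - X ^ 2) * derivative p - C γ * X * p) = 0) →
      ∀ k : ℕ, (k + γ) * M (X ^ (k + 1)) = k * M (X ^ (k - 1)) := by
    intro M hM k
    have eY : (1 - X ^ 2) * derivative ((X : ℝ[X]) ^ k) - C γ * X * X ^ k =
        (k : ℝ) • X ^ (k - 1) - (k + γ) • X ^ (k + 1) := by
      cases k with
      | zero => simp [smul_eq_C_mul]
      | succ k =>
        rw [derivative_X_pow, smul_eq_C_mul, smul_eq_C_mul, Nat.add_sub_cancel]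
        simp only [C_add, map_natCast]
        push_cast; ring
    have h := hM (X ^ k)
    rw [eY, map_sub, map_smul, map_smul, smul_eq_mul, smul_eq_mul] at h
    linarith
  have hpow : ∀ k : ℕ, L (X ^ k) = L' (X ^ k) := by
    intro k
    induction k using Nat.strong_induction_on with
    | _ k ih =>
      match k with
      | 0 => simpa using h1
      | k + 1 =>
        have hne : (k : ℝ) + γ ≠ 0 := by positivity
        apply mul_left_cancel₀ hne
        rw [key L hL, key L' hL', ih (k - 1) (by omega)]
  refine LinearMap.ext fun p => ?_
  induction p using Polynomial.induction_on' with
  | add p q hp hq => rw [map_add, map_add, hp, hq]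
  | monomial n a => rw [← C_mul_X_pow_eq_monomial, ← smul_eq_C_mul, map_smul, map_smul, hpow]

end MomentDeterminacy

/-! ### The law of u·v for v on the sphere. -/

section LawOfCoordinate

open Set

theorem inner_sphere_mem_Icc {V : Type*} [NormedAddCommGroup V] [InnerProductSpace ℝ V]
    {u : V} (hu : ‖u‖ = 1) (v : Metric.sphere (0 : V) 1) :
    inner ℝ u v.1 ∈ Icc (-1 : ℝ) 1 := by
  rw [mem_Icc, ← abs_le]
  simpa [hu] using abs_real_inner_le_norm u v.1

theorem measurable_inner_sphere {V : Type*} [NormedAddCommGroup V] [InnerProductSpace ℝ V]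
    [MeasurableSpace V] [BorelSpace V] (u : V) :
    Measurable fun v : Metric.sphere (0 : V) 1 => inner ℝ u v.1 :=
  Continuous.measurable (by fun_prop)

variable {V : Type*} [NormedAddCommGroup V] [InnerProductSpace ℝ V] [FiniteDimensional ℝ V]
  [MeasurableSpace V] [BorelSpace V]

/-- The ratio of the mass of the unit sphere to the mass of `(1 - x ^ 2) ^ β dx`. -/
noncomputable def sphereRatio (V : Type*) [NormedAddCommGroup V] [InnerProductSpace ℝ V]
    [FiniteDimensional ℝ V] [MeasurableSpace V] [BorelSpace V] (β : ℝ) : ℝ≥0∞ :=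
  (volume : Measure V).toSphere univ / gegenbauerMeasure β univ

theorem sphereRatio_ne_top {β : ℝ} : sphereRatio V β ≠ ⊤ :=
  ENNReal.div_ne_top (measure_ne_top _ _)
    (Measure.measure_univ_ne_zero.2 (gegenbauerMeasure_ne_zero β))

theorem sphereRatio_ne_zero [Nontrivial V] {β : ℝ} (hβ : -(1 / 2) ≤ β) : sphereRatio V β ≠ 0 := by
  have := isFiniteMeasure_gegenbauerMeasure hβ
  refine ENNReal.div_ne_zero.2 ⟨?_, measure_ne_top _ _⟩
  rw [Ne, Measure.measure_univ_eq_zero]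
  exact Measure.toSphere_ne_zero _

/-- The distribution of a coordinate on the unit sphere. -/
theorem map_inner_toSphere [Nontrivial V] {α : ℝ} (hα : 2 * α + 2 = Module.finrank ℝ V)
    (hα0 : 0 ≤ α) {u : V} (hu : ‖u‖ = 1) :
    (volume : Measure V).toSphere.map (fun v => inner ℝ u v.1) =
      sphereRatio V (α - 1 / 2) • gegenbauerMeasure (α - 1 / 2) := by
  have hβ : -(1 / 2) ≤ α - 1 / 2 := by linarith
  have := isFiniteMeasure_gegenbauerMeasure hβ
  have hfin : IsFiniteMeasure (sphereRatio V (α - 1 / 2) • gegenbauerMeasure (α - 1 / 2)) :=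
    Measure.smul_finite _ sphereRatio_ne_top
  have hm1 : ∀ᵐ x ∂((volume : Measure V).toSphere.map (fun v => inner ℝ u v.1)),
      x ∈ Icc (-1 : ℝ) 1 :=
    (ae_map_iff (measurable_inner_sphere u).aemeasurable measurableSet_Icc).2
      (Eventually.of_forall (inner_sphere_mem_Icc hu))
  have hm2 : ∀ᵐ x ∂(sphereRatio V (α - 1 / 2) • gegenbauerMeasure (α - 1 / 2)),
      x ∈ Icc (-1 : ℝ) 1 := by
    refine Measure.ae_smul_measure ?_ _
    filter_upwards [ae_mem_Ioo_gegenbauerMeasure (α - 1 / 2)] with x hx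
      using Ioo_subset_Icc_self hx
  let M (μ : Measure ℝ) [IsFiniteMeasure μ] (hμ : ∀ᵐ x ∂μ, x ∈ Icc (-1 : ℝ) 1) :
      ℝ[X] →ₗ[ℝ] ℝ :=
    { toFun := fun p => ∫ x, p.eval x ∂μ
      map_add' := fun p q => by
        rw [← integral_add (integrable_eval_of_ae_mem_Icc hμ p)
          (integrable_eval_of_ae_mem_Icc hμ q)]
        simp only [eval_add]
      map_smul' := fun c p => by
        rw [RingHom.id_apply, smul_eq_mul, ← integral_const_mul]
        simp only [eval_smul, smul_eq_mul] }
  have hM : M _ hm1 = M _ hm2 := by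
    refine linearMap_eq_of_divergence (γ := 2 * α + 1) (by linarith) (fun p => ?_) (fun p => ?_) ?_
    -- With q = 1 the terms in q' vanish and a one-variable identity remains, the same as that of
    -- the weight on the interval.
    · have h := sphereForm_divergence hα hu u p 1
      rw [derivative_one, mul_zero, map_zero, map_zero, mul_zero, sub_zero, add_zero,
        sphereForm_apply] at h
      change ∫ x, _ ∂_ = _
      rw [integral_map (measurable_inner_sphere u).aemeasurable
        (Polynomial.continuous _).aestronglyMeasurable]
      simpa using h
    · have h := integral_gegenbauerMeasure_divergence hβ p
      rw [show 2 * (α - 1 / 2 + 1) = 2 * α + 1 by ring] at h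
      change ∫ x, _ ∂_ = _
      rw [integral_smul_measure, h, smul_zero]
    · change ∫ x, (1 : ℝ[X]).eval x ∂_ = ∫ x, (1 : ℝ[X]).eval x ∂_
      simp only [eval_one, integral_const, smul_eq_mul, mul_one, measureReal_def]
      rw [Measure.map_apply (measurable_inner_sphere u) MeasurableSet.univ, preimage_univ,
        Measure.smul_apply, smul_eq_mul, sphereRatio, ENNReal.div_mul_cancel
          (Measure.measure_univ_ne_zero.2 (gegenbauerMeasure_ne_zero _)) (measure_ne_top _ _)]
  exact Measure.ext_of_forall_integral_eval hm1 hm2 fun p => LinearMap.congr_fun hM p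

end LawOfCoordinate

/-! ### Weak derivatives against weighted polynomials, by cutoff at the endpoints. -/

section IntegrationByParts

open Set

/-- A smooth function that vanishes on `(-∞, 1]` and equals `1` on `[2, ∞)`. -/
noncomputable def unitCutoff (y : ℝ) : ℝ := Real.smoothTransition (y - 1)

theorem contDiff_unitCutoff : ContDiff ℝ ∞ unitCutoff :=
  Real.smoothTransition.contDiff.comp (contDiff_id.sub contDiff_const)

theorem unitCutoff_of_le {y : ℝ} (hy : y ≤ 1) : unitCutoff y = 0 :=
  Real.smoothTransition.zero_of_nonpos (by linarith)

theorem unitCutoff_of_ge {y : ℝ} (hy : 2 ≤ y) : unitCutoff y = 1 :=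
  Real.smoothTransition.one_of_one_le (by linarith)

theorem norm_unitCutoff_le (y : ℝ) : ‖unitCutoff y‖ ≤ 1 := by
  rw [unitCutoff, Real.norm_of_nonneg (Real.smoothTransition.nonneg _)]
  exact Real.smoothTransition.le_one _

theorem deriv_unitCutoff_of_lt {y : ℝ} (hy : y < 1) : deriv unitCutoff y = 0 := by
  have : unitCutoff =ᶠ[𝓝 y] fun _ => 0 := by
    filter_upwards [Iio_mem_nhds hy] with z hz using unitCutoff_of_le (le_of_lt hz)
  rw [this.deriv_eq, deriv_const]

theorem deriv_unitCutoff_of_gt {y : ℝ} (hy : 2 < y) : deriv unitCutoff y = 0 := by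
  have : unitCutoff =ᶠ[𝓝 y] fun _ => 1 := by
    filter_upwards [Ioi_mem_nhds hy] with z hz using unitCutoff_of_ge (le_of_lt hz)
  rw [this.deriv_eq, deriv_const]

theorem continuous_deriv_unitCutoff : Continuous (deriv unitCutoff) :=
  contDiff_unitCutoff.continuous_deriv (by simp)

/-- The derivative is supported in [1, 2]. With y = r(1 - x²) this bounds the cutoff error uniformly
in r. -/
theorem exists_norm_mul_deriv_unitCutoff_le :
    ∃ K : ℝ, 0 ≤ K ∧ ∀ y, ‖y * deriv unitCutoff y‖ ≤ K := by
  obtain ⟨K, hK⟩ := isCompact_Icc.exists_bound_of_continuousOn (s := Icc (1 : ℝ) 2)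
    (continuous_id.mul continuous_deriv_unitCutoff).continuousOn
  refine ⟨max K 0, le_max_right _ _, fun y => ?_⟩
  rcases lt_or_ge y 1 with h1 | h1
  · simp [deriv_unitCutoff_of_lt h1]
  rcases lt_or_ge 2 y with h2 | h2
  · simp [deriv_unitCutoff_of_gt h2]
  · exact (hK y ⟨h1, h2⟩).trans (le_max_left _ _)

theorem contDiff_rpow_mul_unitCutoff (γ : ℝ) {r : ℝ} (hr : 0 < r) :
    ContDiff ℝ ∞ fun y : ℝ => y ^ γ * unitCutoff (r * y) := by
  rw [contDiff_iff_contDiffAt]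
  intro y
  rcases le_or_gt y 0 with hy | hy
  · have : (fun y : ℝ => y ^ γ * unitCutoff (r * y)) =ᶠ[𝓝 y] fun _ => 0 := by
      filter_upwards [Iio_mem_nhds (hy.trans_lt (inv_pos.2 hr))] with z hz
      have hz' : z < r⁻¹ := hz
      rw [unitCutoff_of_le, mul_zero]
      calc r * z ≤ r * r⁻¹ := by gcongr
        _ = 1 := mul_inv_cancel₀ hr.ne'
    exact contDiffAt_const.congr_of_eventuallyEq this
  · exact (Real.contDiffAt_rpow_const_of_ne hy.ne').mul
      (contDiff_unitCutoff.comp (contDiff_const.mul contDiff_id)).contDiffAt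

/-- The test function `(1 - x ^ 2) ^ γ p x`, cut off near the endpoints of `[-1, 1]`. -/
noncomputable def weightedTest (γ : ℝ) (p : ℝ[X]) (r x : ℝ) : ℝ :=
  (1 - x ^ 2) ^ γ * unitCutoff (r * (1 - x ^ 2)) * p.eval x

theorem contDiff_weightedTest (γ : ℝ) (p : ℝ[X]) {r : ℝ} (hr : 0 < r) :
    ContDiff ℝ ∞ (weightedTest γ p r) :=
  ((contDiff_rpow_mul_unitCutoff γ hr).comp
    (contDiff_const.sub (contDiff_id.pow 2)))
      |>.mul (by simpa using p.contDiff_aeval (𝕜 := ℝ) ∞)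

theorem tsupport_weightedTest (γ : ℝ) (p : ℝ[X]) {r : ℝ} (hr : 0 < r) :
    tsupport (weightedTest γ p r) ⊆ Ioo (-1) 1 := by
  have hclosed : IsClosed {x : ℝ | 1 ≤ r * (1 - x ^ 2)} :=
    isClosed_le continuous_const (by fun_prop)
  refine (closure_minimal (fun x hx => ?_) hclosed).trans fun x hx => ?_
  · by_contra h
    have h' : r * (1 - x ^ 2) < 1 := not_le.1 h
    exact hx (by rw [weightedTest, unitCutoff_of_le h'.le, mul_zero, zero_mul])
  · have hx' : 1 ≤ r * (1 - x ^ 2) := hx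
    have : 0 < 1 - x ^ 2 := pos_of_mul_pos_right (one_pos.trans_le hx') hr.le
    exact ⟨by nlinarith, by nlinarith⟩

theorem hasCompactSupport_weightedTest (γ : ℝ) (p : ℝ[X]) {r : ℝ} (hr : 0 < r) :
    HasCompactSupport (weightedTest γ p r) :=
  isCompact_Icc.of_isClosed_subset (isClosed_tsupport _)
    ((tsupport_weightedTest γ p hr).trans Ioo_subset_Icc_self)

/-- The factor (1 - x²)^β is taken out so that r enters only through χ(y) and y χ'(y) with χ =
`unitCutoff` and y = r(1 - x²), both bounded uniformly in r. -/
theorem deriv_weightedTest (β : ℝ) (p : ℝ[X]) (r : ℝ) {x : ℝ} (hx : x ∈ Ioo (-1 : ℝ) 1) :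
    deriv (weightedTest (β + 1) p r) x = (1 - x ^ 2) ^ β *
      (((1 - X ^ 2) * derivative p - C (2 * (β + 1)) * X * p).eval x
          * unitCutoff (r * (1 - x ^ 2))
        - 2 * x * p.eval x *
          (r * (1 - x ^ 2) * deriv unitCutoff (r * (1 - x ^ 2)))) := by
  have hw := one_sub_sq_pos hx
  have h1 : HasDerivAt (fun x : ℝ => 1 - x ^ 2) (-(2 * x)) x := by
    simpa using (hasDerivAt_pow 2 x).const_sub 1
  have h2 := h1.rpow_const (p := β + 1) (Or.inl hw.ne')
  have h3 : HasDerivAt (fun x : ℝ => unitCutoff (r * (1 - x ^ 2)))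
      (deriv unitCutoff (r * (1 - x ^ 2)) * (r * -(2 * x))) x :=
    ((contDiff_unitCutoff.differentiable (by simp)) _).hasDerivAt.comp x (h1.const_mul r)
  have h4 := (h2.mul h3).mul (p.hasDerivAt x)
  refine h4.deriv.trans ?_
  simp only [Pi.mul_apply]
  rw [add_sub_cancel_right, Real.rpow_add_one hw.ne']
  simp
  ring

/-- Integration by parts of a weak derivative against `(1 - x ^ 2) ^ (β + 1) p x`, which need not
have compact support in `(-1, 1)`. -/
theorem integral_eval_mul_weakDeriv {β : ℝ} {f g : ℝ → ℝ}
    (h : ∀ ψ : ℝ → ℝ, ContDiff ℝ ∞ ψ → HasCompactSupport ψ → tsupport ψ ⊆ Ioo (-1) 1 →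
      ∫ x in Ioo (-1 : ℝ) 1, f x * deriv ψ x = - ∫ x in Ioo (-1 : ℝ) 1, g x * ψ x)
    (hf : Integrable f (gegenbauerMeasure β)) (hg : Integrable g (gegenbauerMeasure (β + 1)))
    (p : ℝ[X]) :
    ∫ x, p.eval x * g x ∂(gegenbauerMeasure (β + 1)) =
      - ∫ x, ((1 - X ^ 2) * derivative p - C (2 * (β + 1)) * X * p).eval x * f x
        ∂(gegenbauerMeasure β) := by
  set R : ℝ[X] := (1 - X ^ 2) * derivative p - C (2 * (β + 1)) * X * p with hR
  rw [integrable_gegenbauerMeasure_iff] at hf hg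
  rw [integral_gegenbauerMeasure, integral_gegenbauerMeasure]
  obtain ⟨KR, hKR0, hKR⟩ := exists_norm_eval_le R
  obtain ⟨Kp, hKp0, hKp⟩ := exists_norm_eval_le p
  obtain ⟨K, hK0, hK⟩ := exists_norm_mul_deriv_unitCutoff_le
  have hcut := contDiff_unitCutoff.continuous
  have hcut' := continuous_deriv_unitCutoff
  -- At a fixed interior point the cutoff eventually equals 1 and its derivative 0, so both
  -- integrands become stationary there and dominated convergence applies.
  have hlim : ∀ x ∈ Ioo (-1 : ℝ) 1,
      ∀ᶠ n : ℕ in atTop, 2 < ((n : ℝ) + 1) * (1 - x ^ 2) := fun x hx =>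
    ((tendsto_natCast_atTop_atTop.atTop_add tendsto_const_nhds).atTop_mul_const
      (one_sub_sq_pos hx)).eventually_gt_atTop 2
  have hL : Tendsto (fun n : ℕ => ∫ x in Ioo (-1 : ℝ) 1,
      f x * deriv (weightedTest (β + 1) p ((n : ℝ) + 1)) x) atTop
      (𝓝 (∫ x in Ioo (-1 : ℝ) 1, (1 - x ^ 2) ^ β * (R.eval x * f x))) := by
    have e : ∀ n : ℕ, ∫ x in Ioo (-1 : ℝ) 1,
        f x * deriv (weightedTest (β + 1) p ((n : ℝ) + 1)) x =
        ∫ x in Ioo (-1 : ℝ) 1, (1 - x ^ 2) ^ β * f x *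
          (R.eval x * unitCutoff (((n : ℝ) + 1) * (1 - x ^ 2))
            - 2 * x * p.eval x * (((n : ℝ) + 1) * (1 - x ^ 2) *
              deriv unitCutoff (((n : ℝ) + 1) * (1 - x ^ 2)))) := fun n => by
      refine setIntegral_congr_fun measurableSet_Ioo fun x hx => ?_
      simp only [deriv_weightedTest β p _ hx, ← hR]
      ring
    simp_rw [e]
    refine tendsto_integral_of_dominated_convergence
      (fun x => ‖(1 - x ^ 2) ^ β * f x‖ * (KR * 1 + 2 * Kp * K))
      (fun n => hf.aestronglyMeasurable.mul (Continuous.aestronglyMeasurable ?_))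
      (hf.norm.mul_const _) (fun n => ?_) ?_
    · fun_prop
    · filter_upwards [ae_restrict_mem measurableSet_Ioo] with x hx
      have hx1 : ‖x‖ ≤ 1 := abs_le.2 ⟨hx.1.le, hx.2.le⟩
      rw [norm_mul]
      refine mul_le_mul_of_nonneg_left ((norm_sub_le _ _).trans ?_) (norm_nonneg _)
      rw [norm_mul, norm_mul, norm_mul, norm_mul]
      refine add_le_add (mul_le_mul (hKR x (Ioo_subset_Icc_self hx)) (norm_unitCutoff_le _)
        (norm_nonneg _) hKR0) (mul_le_mul (mul_le_mul ?_ (hKp x (Ioo_subset_Icc_self hx))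
          (norm_nonneg _) (by norm_num)) (hK _) (norm_nonneg _) (by positivity))
      rw [Real.norm_ofNat]
      linarith
    · filter_upwards [ae_restrict_mem measurableSet_Ioo] with x hx
      refine tendsto_const_nhds.congr' ?_
      filter_upwards [hlim x hx] with n hn
      rw [unitCutoff_of_ge hn.le, deriv_unitCutoff_of_gt hn]
      ring
  have hG : Tendsto (fun n : ℕ => ∫ x in Ioo (-1 : ℝ) 1,
      g x * weightedTest (β + 1) p ((n : ℝ) + 1) x) atTop
      (𝓝 (∫ x in Ioo (-1 : ℝ) 1, (1 - x ^ 2) ^ (β + 1) * (p.eval x * g x))) := by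
    have e : ∀ n : ℕ, ∫ x in Ioo (-1 : ℝ) 1, g x * weightedTest (β + 1) p ((n : ℝ) + 1) x =
        ∫ x in Ioo (-1 : ℝ) 1, (1 - x ^ 2) ^ (β + 1) * g x *
          (p.eval x * unitCutoff (((n : ℝ) + 1) * (1 - x ^ 2))) := fun n => by
      refine integral_congr_ae (Eventually.of_forall fun x => ?_)
      simp only [weightedTest]
      ring
    simp_rw [e]
    refine tendsto_integral_of_dominated_convergence
      (fun x => ‖(1 - x ^ 2) ^ (β + 1) * g x‖ * (Kp * 1))
      (fun n => hg.aestronglyMeasurable.mul (Continuous.aestronglyMeasurable ?_))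
      (hg.norm.mul_const _) (fun n => ?_) ?_
    · fun_prop
    · filter_upwards [ae_restrict_mem measurableSet_Ioo] with x hx
      rw [norm_mul, norm_mul (p.eval x)]
      exact mul_le_mul_of_nonneg_left (mul_le_mul (hKp x (Ioo_subset_Icc_self hx))
        (norm_unitCutoff_le _) (norm_nonneg _) hKp0) (norm_nonneg _)
    · filter_upwards [ae_restrict_mem measurableSet_Ioo] with x hx
      refine tendsto_const_nhds.congr' ?_
      filter_upwards [hlim x hx] with n hn
      rw [unitCutoff_of_ge hn.le]
      ring
  refine tendsto_nhds_unique hG ((hL.neg).congr fun n => ?_)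
  have hn : (0 : ℝ) < (n : ℝ) + 1 := by positivity
  rw [h _ (contDiff_weightedTest _ p hn) (hasCompactSupport_weightedTest _ p hn)
    (tsupport_weightedTest _ p hn), neg_neg]

/-- Rescaling of weak derivatives. -/
theorem IsWeakDerivOn.integral_comp_mul {r : ℝ} (hr : 0 < r) {f g : ℝ → ℝ}
    (h : IsWeakDerivOn (Ioo (-r) r) f g) {ψ : ℝ → ℝ} (hψ : ContDiff ℝ ∞ ψ)
    (hc : HasCompactSupport ψ) (hs : tsupport ψ ⊆ Ioo (-1) 1) :
    ∫ x in Ioo (-1 : ℝ) 1, f (r * x) * deriv ψ x =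
      - ∫ x in Ioo (-1 : ℝ) 1, r * g (r * x) * ψ x := by
  have hscale : ∀ F : ℝ → ℝ, ∫ x in Ioo (-r) r, F x = r * ∫ x in Ioo (-1 : ℝ) 1, F (r * x) := by
    intro F
    rw [← integral_Ioc_eq_integral_Ioo, ← integral_Ioc_eq_integral_Ioo,
      ← intervalIntegral.integral_of_le (by linarith),
      ← intervalIntegral.integral_of_le (by norm_num),
      intervalIntegral.integral_comp_mul_left F hr.ne', smul_eq_mul, mul_inv_cancel_left₀ hr.ne']
    simp
  let e : ℝ ≃ₜ ℝ := Homeomorph.mulLeft₀ r⁻¹ (inv_ne_zero hr.ne')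
  have h1 := h.integral_eq (fun x => ψ (r⁻¹ * x)) (hψ.comp (contDiff_const.mul contDiff_id))
    (hc.comp_homeomorph e) ?_
  · rw [hscale, hscale] at h1
    have hd : ∀ x, deriv (fun x => ψ (r⁻¹ * x)) (r * x) = r⁻¹ * deriv ψ x := fun x => by
      rw [deriv_comp_mul_left, inv_mul_cancel_left₀ hr.ne', smul_eq_mul]
    simp only [hd, inv_mul_cancel_left₀ hr.ne'] at h1
    rw [← integral_const_mul] at h1
    have h2 : ∀ x, r * (f (r * x) * (r⁻¹ * deriv ψ x)) = f (r * x) * deriv ψ x := fun x => by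
      field_simp
    simp only [h2] at h1
    rw [h1, ← integral_const_mul]
    congr 1
    refine integral_congr_ae (Eventually.of_forall fun x => ?_)
    simp only
    ring
  · intro x hx
    have hx' : r⁻¹ * x ∈ tsupport ψ := tsupport_comp_subset_preimage ψ e.continuous hx
    have h3 := hs hx'
    have h4 : x = r * (r⁻¹ * x) := by rw [mul_inv_cancel_left₀ hr.ne']
    rw [h4]
    constructor <;> nlinarith [h3.1, h3.2]

end IntegrationByParts

/-! ### Comparison of weights, density of polynomials, and expansion coefficients. -/

section WeightComparison

open Set

theorem gegenbauerMeasure_anti {β γ : ℝ} (h : β ≤ γ) :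
    gegenbauerMeasure γ ≤ gegenbauerMeasure β := by
  refine withDensity_mono ?_
  filter_upwards [ae_restrict_mem measurableSet_Ioo] with x hx
  exact ENNReal.ofReal_le_ofReal (Real.rpow_le_rpow_of_exponent_ge (one_sub_sq_pos hx)
    (one_sub_sq_le_one x) h)

theorem aestronglyMeasurable_gegenbauerMeasure_congr {β γ : ℝ} {f : ℝ → ℝ}
    (hf : AEStronglyMeasurable f (gegenbauerMeasure β)) :
    AEStronglyMeasurable f (gegenbauerMeasure γ) :=
  hf.mono_ac ((gegenbauerMeasure_absolutelyContinuous γ).trans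
    (absolutelyContinuous_gegenbauerMeasure β))

theorem integral_one_sub_sq_mul_gegenbauerMeasure (β : ℝ) (f : ℝ → ℝ) :
    ∫ x, (1 - x ^ 2) * f x ∂(gegenbauerMeasure β) = ∫ x, f x ∂(gegenbauerMeasure (β + 1)) := by
  rw [integral_gegenbauerMeasure, integral_gegenbauerMeasure]
  refine setIntegral_congr_fun measurableSet_Ioo fun x hx => ?_
  simp only [Real.rpow_add_one (one_sub_sq_pos hx).ne', mul_assoc]

theorem integrable_one_sub_sq_mul_gegenbauerMeasure_iff {β : ℝ} {f : ℝ → ℝ} :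
    Integrable (fun x => (1 - x ^ 2) * f x) (gegenbauerMeasure β) ↔
      Integrable f (gegenbauerMeasure (β + 1)) := by
  rw [integrable_gegenbauerMeasure_iff, integrable_gegenbauerMeasure_iff]
  refine integrableOn_congr_fun (fun x hx => ?_) measurableSet_Ioo
  simp only [Real.rpow_add_one (one_sub_sq_pos hx).ne', mul_assoc]

/-- The `L¹` norm for the weight `(1 - x ^ 2) ^ (α - 1 / 2)` is controlled by the `L²` norm for
the weight `(1 - x ^ 2) ^ α`. -/
theorem exists_eLpNorm_one_le_eLpNorm_two {α : ℝ} (hα : 1 / 2 ≤ α) :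
    ∃ K : ℝ≥0∞, K ≠ ⊤ ∧ ∀ f : ℝ → ℝ, AEStronglyMeasurable f (gegenbauerMeasure α) →
      eLpNorm f 1 (gegenbauerMeasure (α - 1 / 2)) ≤ K * eLpNorm f 2 (gegenbauerMeasure α) := by
  -- The ratio of the two densities. It is square integrable for exponent α since α - 1 ≥ -1/2, and
  -- Hölder's inequality does the rest.
  set φ : ℝ → ℝ := fun x => (1 - x ^ 2) ^ (-(1 / 2) : ℝ) with hφ
  have hφm : Measurable φ := by fun_prop
  have hφL : MemLp φ 2 (gegenbauerMeasure α) := by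
    rw [memLp_two_iff_integrable_sq hφm.aestronglyMeasurable, integrable_gegenbauerMeasure_iff]
    refine (integrableOn_one_sub_sq_rpow (β := α - 1) (by linarith)).congr_fun (fun x hx => ?_)
      measurableSet_Ioo
    have hw := one_sub_sq_pos hx
    simp only [hφ]
    rw [← Real.rpow_mul_natCast hw.le, ← Real.rpow_add hw]
    norm_num [sub_eq_add_neg]
  refine ⟨eLpNorm φ 2 (gegenbauerMeasure α), hφL.eLpNorm_ne_top, fun f hf => ?_⟩
  have h1 : eLpNorm f 1 (gegenbauerMeasure (α - 1 / 2)) =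
      eLpNorm (φ • f) 1 (gegenbauerMeasure α) := by
    rw [eLpNorm_one_eq_lintegral_enorm, eLpNorm_one_eq_lintegral_enorm, gegenbauerMeasure,
      gegenbauerMeasure, lintegral_withDensity_eq_lintegral_mul_non_measurable _
        (measurable_gegenbauerDensity _) (by simp),
      lintegral_withDensity_eq_lintegral_mul_non_measurable _
        (measurable_gegenbauerDensity _) (by simp)]
    refine setLIntegral_congr_fun measurableSet_Ioo fun x hx => ?_
    have hw := one_sub_sq_pos hx
    simp only [Pi.mul_apply, Pi.smul_apply', smul_eq_mul, hφ, enorm_mul]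
    rw [← mul_assoc, Real.enorm_of_nonneg (Real.rpow_nonneg hw.le _),
      ← ENNReal.ofReal_mul (Real.rpow_nonneg hw.le _), ← Real.rpow_add hw, ← sub_eq_add_neg α]
  rw [h1]
  exact eLpNorm_smul_le_mul_eLpNorm hf hφm.aestronglyMeasurable

theorem MemLp.integrable_gegenbauerMeasure_sub_half {α : ℝ} (hα : 1 / 2 ≤ α) {f : ℝ → ℝ}
    (hf : MemLp f 2 (gegenbauerMeasure α)) : Integrable f (gegenbauerMeasure (α - 1 / 2)) := by
  obtain ⟨K, hK, h⟩ := exists_eLpNorm_one_le_eLpNorm_two hα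
  refine memLp_one_iff_integrable.1 ⟨aestronglyMeasurable_gegenbauerMeasure_congr
    hf.aestronglyMeasurable, (h f hf.aestronglyMeasurable).trans_lt ?_⟩
  exact ENNReal.mul_lt_top hK.lt_top hf.eLpNorm_lt_top

/-- Polynomials are dense in the weighted `L²` space. -/
theorem exists_eval_eLpNorm_sub_lt {β : ℝ} (hβ : -(1 / 2) ≤ β) {g : ℝ → ℝ}
    (hg : MemLp g 2 (gegenbauerMeasure β)) {ε : ℝ} (hε : 0 < ε) :
    ∃ p : ℝ[X], eLpNorm (fun x => g x - p.eval x) 2 (gegenbauerMeasure β) < ENNReal.ofReal ε := by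
  have := isFiniteMeasure_gegenbauerMeasure hβ
  set M : ℝ := (gegenbauerMeasure β univ ^ (1 / 2 : ℝ)).toReal with hM
  have hM' : gegenbauerMeasure β univ ^ (1 / 2 : ℝ) = ENNReal.ofReal M :=
    (ENNReal.ofReal_toReal (ENNReal.rpow_ne_top_of_nonneg (by norm_num) (measure_ne_top _ _))).symm
  have hM0 : 0 ≤ M := ENNReal.toReal_nonneg
  obtain ⟨f, hf, hfm⟩ := hg.exists_boundedContinuous_eLpNorm_sub_le (by norm_num)
    (ε := ENNReal.ofReal (ε / 3)) (by simpa using hε)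
  obtain ⟨p, hp⟩ := exists_polynomial_near_of_continuousOn (-1) 1 f f.continuous.continuousOn
    (ε / 3 / (M + 1)) (by positivity)
  refine ⟨p, ?_⟩
  have h1 : eLpNorm (fun x => f x - p.eval x) 2 (gegenbauerMeasure β) ≤
      ENNReal.ofReal (ε / 3) := by
    have h2 : eLpNorm (fun x => f x - p.eval x) 2 (gegenbauerMeasure β) ≤
        gegenbauerMeasure β univ ^ (2 : ℝ≥0∞).toReal⁻¹ * ENNReal.ofReal (ε / 3 / (M + 1)) := by
      refine eLpNorm_le_of_ae_bound ?_
      filter_upwards [ae_mem_Ioo_gegenbauerMeasure β] with x hx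
      rw [norm_sub_rev]
      exact (hp x (Ioo_subset_Icc_self hx)).le
    rw [ENNReal.toReal_ofNat, ← one_div, hM', ← ENNReal.ofReal_mul hM0] at h2
    refine h2.trans (ENNReal.ofReal_le_ofReal ?_)
    rw [mul_div_assoc', div_le_iff₀ (by positivity)]
    nlinarith
  calc eLpNorm (fun x => g x - p.eval x) 2 (gegenbauerMeasure β)
      = eLpNorm ((fun x => g x - f x) + fun x => f x - p.eval x) 2 (gegenbauerMeasure β) := by
        congr 1; ext x; simp
    _ ≤ ENNReal.ofReal (ε / 3) + ENNReal.ofReal (ε / 3) :=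
        (eLpNorm_add_le (hg.aestronglyMeasurable.sub hfm.aestronglyMeasurable)
          (hfm.aestronglyMeasurable.sub p.continuous.aestronglyMeasurable) (by norm_num)).trans
          (add_le_add hf h1)
    _ < ENNReal.ofReal ε := by
        rw [← ENNReal.ofReal_add (by positivity) (by positivity)]
        exact (ENNReal.ofReal_lt_ofReal_iff hε).2 (by linarith)

/-- The coefficients of an expansion in orthogonal polynomials for the weight
`(1 - x ^ 2) ^ (α - 1 / 2)` that converges in `L²` for the weight `(1 - x ^ 2) ^ α`. -/
theorem integral_eval_mul_eq_coeff {α : ℝ} (hα : 1 / 2 ≤ α) {P : ℕ → ℝ[X]}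
    (hP : ∀ l m, l ≠ m →
      ∫ x, (P l).eval x * (P m).eval x ∂(gegenbauerMeasure (α - 1 / 2)) = 0)
    {f : ℝ → ℝ} (hf : MemLp f 2 (gegenbauerMeasure α)) {b : ℕ → ℝ}
    (hb : Tendsto (fun n : ℕ => eLpNorm
      (fun x => f x - ∑ l ∈ Finset.range n, b l * (P l).eval x) 2 (gegenbauerMeasure α))
      atTop (𝓝 0)) (m : ℕ) :
    ∫ x, (P m).eval x * f x ∂(gegenbauerMeasure (α - 1 / 2)) =
      b m * ∫ x, (P m).eval x * (P m).eval x ∂(gegenbauerMeasure (α - 1 / 2)) := by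
  have hβ : -(1 / 2) ≤ α - 1 / 2 := by linarith
  set μ := gegenbauerMeasure (α - 1 / 2) with hμ
  have := isFiniteMeasure_gegenbauerMeasure hβ
  obtain ⟨C, hC, hL1⟩ := exists_eLpNorm_one_le_eLpNorm_two hα
  obtain ⟨K, hK0, hK⟩ := exists_norm_eval_le (P m)
  set S : ℕ → ℝ[X] := fun n => ∑ l ∈ Finset.range n, b l • P l with hS
  have hSe : ∀ n x, (S n).eval x = ∑ l ∈ Finset.range n, b l * (P l).eval x := fun n x => by
    simp [hS, eval_finsetSum]
  simp_rw [← hSe] at hb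
  have hpoly : ∀ p : ℝ[X], Integrable (fun x => p.eval x) μ := fun p =>
    memLp_one_iff_integrable.1 (memLp_eval_gegenbauerMeasure hβ p 1)
  have hPm : ∀ {h : ℝ → ℝ}, Integrable h μ → Integrable (fun x => (P m).eval x * h x) μ := by
    intro h hh
    refine hh.bdd_mul (P m).continuous.aestronglyMeasurable (c := K) ?_
    filter_upwards [ae_mem_Ioo_gegenbauerMeasure (α - 1 / 2)] with x hx
    exact hK x (Ioo_subset_Icc_self hx)
  have hfint : Integrable f μ := MemLp.integrable_gegenbauerMeasure_sub_half hα hf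
  -- The partial sums converge in L¹ of the orthogonality weight, which is enough for pairing with a
  -- bounded polynomial.
  have hlim : Tendsto (fun n => ∫ x, (P m).eval x * (S n).eval x ∂μ) atTop
      (𝓝 (∫ x, (P m).eval x * f x ∂μ)) := by
    refine tendsto_integral_of_L1' _ (hPm hfint).aestronglyMeasurable
      (Eventually.of_forall fun n => hPm (hpoly (S n))) ?_
    have h0 : Tendsto (fun n => ENNReal.ofReal K * (C * eLpNorm (fun x => f x - (S n).eval x) 2
        (gegenbauerMeasure α))) atTop (𝓝 0) := by
      have := ENNReal.Tendsto.const_mul (a := ENNReal.ofReal K)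
        (ENNReal.Tendsto.const_mul (a := C) hb (Or.inr hC)) (Or.inr ENNReal.ofReal_ne_top)
      simpa using this
    refine tendsto_of_tendsto_of_tendsto_of_le_of_le tendsto_const_nhds h0 (fun _ => zero_le) ?_
    intro n
    refine le_trans ?_ (mul_le_mul_right (hL1 _ (hf.aestronglyMeasurable.sub
      (S n).continuous.aestronglyMeasurable)) _)
    refine eLpNorm_le_mul_eLpNorm_of_ae_le_mul ?_ 1
    filter_upwards [ae_mem_Ioo_gegenbauerMeasure (α - 1 / 2)] with x hx
    rw [Pi.sub_apply, ← mul_sub, norm_mul, norm_sub_rev]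
    exact mul_le_mul_of_nonneg_right (hK x (Ioo_subset_Icc_self hx)) (norm_nonneg _)
  refine tendsto_nhds_unique hlim (tendsto_const_nhds.congr' ?_)
  filter_upwards [eventually_gt_atTop m] with n hn
  have h1 : ∀ x, (P m).eval x * (S n).eval x =
      ∑ l ∈ Finset.range n, b l * ((P m).eval x * (P l).eval x) := fun x => by
    rw [hSe, Finset.mul_sum]
    exact Finset.sum_congr rfl fun l _ => by ring
  simp_rw [h1]
  rw [integral_finsetSum _ fun l _ => (hPm (hpoly (P l))).const_mul _,
    Finset.sum_eq_single m]
  · rw [integral_const_mul]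
  · intro l _ hl
    rw [integral_const_mul, hP m l hl.symm, mul_zero]
  · intro h
    exact absurd (Finset.mem_range.2 hn) h

end WeightComparison

/-! ### Orthogonal expansions in an inner product space. -/

section OrthogonalExpansion

variable {H : Type*} [NormedAddCommGroup H] [InnerProductSpace ℝ H]

/-- A partial sum over s is the best approximation of y from the span of the x i with i ∈ s, so it
is at least as close as any approximant supported in s. The coefficient condition avoids division
because x i may vanish; it does for the gradient of C_0. -/
theorem hasSum_of_mem_closure_span {ι : Type*} {x : ι → H}
    (hx : ∀ i j, i ≠ j → inner ℝ (x i) (x j) = 0) {y : H}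
    (hy : y ∈ closure (Submodule.span ℝ (Set.range x) : Set H)) {b : ι → ℝ}
    (hb : ∀ i, inner ℝ (x i) y = b i * inner ℝ (x i) (x i)) :
    HasSum (fun i => b i • x i) y := by
  classical
  refine Metric.tendsto_atTop.2 fun ε hε => ?_
  obtain ⟨z, hz, hzy⟩ := Metric.mem_closure_iff.1 hy ε hε
  obtain ⟨c, rfl⟩ := (Finsupp.mem_span_range_iff_exists_finsupp).1 hz
  refine ⟨c.support, fun s hs => ?_⟩
  set P := ∑ i ∈ s, b i • x i with hP
  have hPx : ∀ i ∈ s, inner ℝ (y - P) (x i) = 0 := by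
    intro i hi
    rw [inner_sub_left, hP, sum_inner, Finset.sum_eq_single_of_mem i hi, inner_smul_left,
      real_inner_comm, hb i]
    · simp
    · intro j _ hj
      rw [inner_smul_left, hx j i hj, mul_zero]
  set z := c.sum fun i a => a • x i with hzdef
  have hzs : z = ∑ i ∈ s, c i • x i :=
    Finsupp.sum_of_support_subset c hs _ fun i _ => zero_smul _ _
  have hort : inner ℝ (y - P) (P - z) = 0 := by
    rw [hzs, hP, ← Finset.sum_sub_distrib, inner_sum]
    refine Finset.sum_eq_zero fun i hi => ?_
    rw [← sub_smul, inner_smul_right, ← hP, hPx i hi, mul_zero]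
  have hpyth := norm_add_sq_eq_norm_sq_add_norm_sq_of_inner_eq_zero (y - P) (P - z) hort
  rw [sub_add_sub_cancel] at hpyth
  have hle : ‖y - P‖ ≤ ‖y - z‖ := by
    nlinarith [norm_nonneg (y - P), norm_nonneg (y - z), norm_nonneg (P - z)]
  rw [dist_comm, dist_eq_norm]
  exact hle.trans_lt (by rwa [dist_eq_norm] at hzy)

/-- By continuity of the inner product, pairing x i with Y keeps only y i; then X is paired with Y
term by term. It is used for the gradient systems of two different poles. -/
theorem HasSum.inner_biorthogonal {ι : Type*} {x y : ι → H} {X Y : H} (hx : HasSum x X)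
    (hy : HasSum y Y) (hxy : ∀ i j, i ≠ j → inner ℝ (x i) (y j) = 0) :
    HasSum (fun i => inner ℝ (x i) (y i)) (inner ℝ X Y) := by
  have h1 : ∀ i, inner ℝ (x i) (y i) = inner ℝ (x i) Y := fun i =>
    (hasSum_single i fun j hj => hxy i j hj.symm).unique (hy.mapL (innerSL ℝ (x i)))
  simp_rw [h1, ← real_inner_comm _ Y]
  exact hx.mapL (innerSL ℝ Y)

end OrthogonalExpansion

/-! ### Zonal gradient fields in L² and their Dirichlet form. -/

section TangentialFields

open Set

variable {V : Type*} [NormedAddCommGroup V] [InnerProductSpace ℝ V]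

/-- The vector field `v ↦ g (u ⬝ v) (u - (u ⬝ v) v)` on the unit sphere: the gradient of
`v ↦ G (u ⬝ v)` if `G' = g`. -/
noncomputable def zonalField (u : V) (g : ℝ → ℝ) (v : Metric.sphere (0 : V) 1) : V :=
  g (inner ℝ u v.1) • (u - inner ℝ u v.1 • v.1)

theorem inner_zonalField (u w : V) (g h : ℝ → ℝ) (v : Metric.sphere (0 : V) 1) :
    inner ℝ (zonalField u g v) (zonalField w h v) =
      (inner ℝ u w - inner ℝ u v.1 * inner ℝ w v.1) *
        (g (inner ℝ u v.1) * h (inner ℝ w v.1)) := by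
  have hv : inner ℝ v.1 v.1 = (1 : ℝ) := by
    rw [real_inner_self_eq_norm_sq, norm_eq_of_mem_sphere, one_pow]
  simp only [zonalField, inner_smul_left, inner_smul_right, inner_sub_left, inner_sub_right, hv,
    RCLike.conj_to_real]
  rw [real_inner_comm w v.1]
  ring

theorem norm_zonalField_sq {u : V} (hu : ‖u‖ = 1) (g : ℝ → ℝ) (v : Metric.sphere (0 : V) 1) :
    ‖zonalField u g v‖ ^ 2 = (1 - inner ℝ u v.1 ^ 2) * g (inner ℝ u v.1) ^ 2 := by
  rw [← real_inner_self_eq_norm_sq, inner_zonalField, real_inner_self_eq_norm_sq, hu]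
  ring

variable [FiniteDimensional ℝ V] [MeasurableSpace V] [BorelSpace V] {α : ℝ}

theorem aestronglyMeasurable_comp_inner [Nontrivial V] (hα : 2 * α + 2 = Module.finrank ℝ V) (hα0 : 0 ≤ α)
    {u : V} (hu : ‖u‖ = 1) {β : ℝ} {F : ℝ → ℝ}
    (hF : AEStronglyMeasurable F (gegenbauerMeasure β)) :
    AEStronglyMeasurable (fun v : Metric.sphere (0 : V) 1 => F (inner ℝ u v.1))
      (volume : Measure V).toSphere := by
  refine AEStronglyMeasurable.comp_measurable ?_ (measurable_inner_sphere u)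
  rw [map_inner_toSphere hα hα0 hu]
  exact (aestronglyMeasurable_gegenbauerMeasure_congr hF).smul_measure _

theorem integral_comp_inner [Nontrivial V] (hα : 2 * α + 2 = Module.finrank ℝ V) (hα0 : 0 ≤ α)
    {u : V} (hu : ‖u‖ = 1) {β : ℝ} {F : ℝ → ℝ}
    (hF : AEStronglyMeasurable F (gegenbauerMeasure β)) :
    ∫ v : Metric.sphere (0 : V) 1, F (inner ℝ u v.1) ∂(volume : Measure V).toSphere =
      (sphereRatio V (α - 1 / 2)).toReal * ∫ x, F x ∂(gegenbauerMeasure (α - 1 / 2)) := by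
  rw [← smul_eq_mul, ← integral_smul_measure, ← map_inner_toSphere hα hα0 hu,
    integral_map (measurable_inner_sphere u).aemeasurable]
  rw [map_inner_toSphere hα hα0 hu]
  exact (aestronglyMeasurable_gegenbauerMeasure_congr hF).smul_measure _

theorem integrable_comp_inner [Nontrivial V] (hα : 2 * α + 2 = Module.finrank ℝ V) (hα0 : 0 ≤ α)
    {u : V} (hu : ‖u‖ = 1) {F : ℝ → ℝ} (hF : Integrable F (gegenbauerMeasure (α - 1 / 2))) :
    Integrable (fun v : Metric.sphere (0 : V) 1 => F (inner ℝ u v.1))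
      (volume : Measure V).toSphere := by
  have h : Integrable F ((volume : Measure V).toSphere.map fun v => inner ℝ u v.1) := by
    rw [map_inner_toSphere hα hα0 hu]
    exact hF.smul_measure sphereRatio_ne_top
  exact h.comp_measurable (measurable_inner_sphere u)

theorem memLp_zonalField [Nontrivial V] (hα : 2 * α + 2 = Module.finrank ℝ V) (hα0 : 0 ≤ α)
    {u : V} (hu : ‖u‖ = 1) {g : ℝ → ℝ} (hg : MemLp g 2 (gegenbauerMeasure (α + 1 / 2))) :
    MemLp (zonalField u g) 2 (volume : Measure V).toSphere := by
  have hm : AEStronglyMeasurable (zonalField u g) (volume : Measure V).toSphere :=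
    (aestronglyMeasurable_comp_inner hα hα0 hu hg.aestronglyMeasurable).smul
      (Continuous.aestronglyMeasurable (by fun_prop))
  rw [memLp_two_iff_integrable_sq_norm hm]
  simp_rw [norm_zonalField_sq hu]
  refine integrable_comp_inner hα hα0 hu (F := fun x => (1 - x ^ 2) * g x ^ 2) ?_
  rw [integrable_one_sub_sq_mul_gegenbauerMeasure_iff,
    show α - 1 / 2 + 1 = α + 1 / 2 by ring]
  exact hg.integrable_sq

theorem integral_inner_zonalField [Nontrivial V] (hα : 2 * α + 2 = Module.finrank ℝ V) (hα0 : 0 ≤ α)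
    {u : V} (hu : ‖u‖ = 1) {g h : ℝ → ℝ} {β : ℝ}
    (hg : AEStronglyMeasurable g (gegenbauerMeasure β))
    (hh : AEStronglyMeasurable h (gegenbauerMeasure β)) :
    ∫ v, inner ℝ (zonalField u g v) (zonalField u h v) ∂(volume : Measure V).toSphere =
      (sphereRatio V (α - 1 / 2)).toReal * ∫ x, g x * h x ∂(gegenbauerMeasure (α + 1 / 2)) := by
  have e : ∀ v, inner ℝ (zonalField u g v) (zonalField u h v) =
      (fun x => (1 - x ^ 2) * (g x * h x)) (inner ℝ u v.1) := fun v => by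
    rw [inner_zonalField, real_inner_self_eq_norm_sq, hu]
    ring
  simp_rw [e]
  rw [integral_comp_inner hα hα0 hu (F := fun x => (1 - x ^ 2) * (g x * h x)) (β := β),
    integral_one_sub_sq_mul_gegenbauerMeasure, show α - 1 / 2 + 1 = α + 1 / 2 by ring]
  exact (Measurable.aestronglyMeasurable (by fun_prop)).mul (hg.mul hh)

theorem inner_toLp_zonalField {u w : V} {g h : ℝ → ℝ}
    (hg : MemLp (zonalField u g) 2 (volume : Measure V).toSphere)
    (hh : MemLp (zonalField w h) 2 (volume : Measure V).toSphere) :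
    inner ℝ hg.toLp hh.toLp =
      ∫ v, inner ℝ (zonalField u g v) (zonalField w h v) ∂(volume : Measure V).toSphere := by
  rw [L2.inner_def]
  refine integral_congr_ae ?_
  filter_upwards [hg.coeFn_toLp, hh.coeFn_toLp] with v h1 h2
  rw [h1, h2]

theorem memLp_zonalField_eval (u : V) (p : ℝ[X]) :
    MemLp (zonalField u fun x => p.eval x) 2 (volume : Measure V).toSphere := by
  have hc : Continuous (zonalField u fun x => p.eval x) :=
    (p.continuous.comp (by fun_prop)).smul (by fun_prop)
  rw [memLp_two_iff_integrable_sq_norm hc.aestronglyMeasurable]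
  exact (hc.norm.pow 2).integrable_toSphere

/-- The zonal field of a polynomial as an element of `L²`, linear in the polynomial. -/
noncomputable def polynomialZonalField (u : V) : ℝ[X] →ₗ[ℝ] Lp V 2 (volume : Measure V).toSphere where
  toFun p := (memLp_zonalField_eval u p).toLp
  map_add' p q := by
    rw [← MemLp.toLp_add]
    congr 1
    ext v
    simp [zonalField, add_smul]
  map_smul' c p := by
    rw [RingHom.id_apply, ← MemLp.toLp_const_smul]
    congr 1
    ext v
    simp [zonalField, mul_smul]

/-- This is the combination evaluated by the `IsZonalForm` identities, which thus become statements
about inner products of gradients. -/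
theorem inner_polynomialZonalField (u w : V) (p q : ℝ[X]) :
    inner ℝ (polynomialZonalField u p) (polynomialZonalField w q) =
      inner ℝ u w * sphereForm u w p q - sphereForm u w (X * p) (X * q) := by
  refine (inner_toLp_zonalField (memLp_zonalField_eval u p) (memLp_zonalField_eval w q)).trans ?_
  rw [sphereForm_apply, sphereForm_apply, ← integral_const_mul, ← integral_sub
    (Continuous.integrable_toSphere (by fun_prop)) (Continuous.integrable_toSphere (by fun_prop))]
  refine integral_congr_ae (Eventually.of_forall fun v => ?_)
  simp only [inner_zonalField, eval_mul, eval_X]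
  ring

theorem sphereForm_self [Nontrivial V] (hα : 2 * α + 2 = Module.finrank ℝ V) (hα0 : 0 ≤ α)
    {u : V} (hu : ‖u‖ = 1) (p q : ℝ[X]) :
    sphereForm u u p q = (sphereRatio V (α - 1 / 2)).toReal *
      ∫ x, p.eval x * q.eval x ∂(gegenbauerMeasure (α - 1 / 2)) :=
  integral_comp_inner hα hα0 hu (β := α) (F := fun x => p.eval x * q.eval x)
    (Continuous.aestronglyMeasurable (by fun_prop))

theorem isZonalForm_sphereForm [Nontrivial V] (hα : 2 * α + 2 = Module.finrank ℝ V) {u w : V} (hu : ‖u‖ = 1)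
    (hw : ‖w‖ = 1) : IsZonalForm α (inner ℝ u w) (sphereForm u w) := by
  refine ⟨sphereForm_divergence hα hu w, fun p q => ?_⟩
  rw [sphereForm_comm u w p, sphereForm_comm u w (derivative p), sphereForm_comm u w (X * _),
    real_inner_comm]
  exact sphereForm_divergence hα hw u q p

theorem sphereForm_one_one (u w : V) :
    sphereForm u w 1 1 = (volume : Measure V).toSphere.real univ := by
  simp [sphereForm_apply]

/-- Up to a constant factor, g ↦ `zonalField u g` preserves the L² norm of the weight with exponent
α + 1/2, where polynomials are dense; the derivatives C_l' span all polynomials. -/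
theorem toLp_zonalField_mem_closure_span [Nontrivial V] (hα : 2 * α + 2 = Module.finrank ℝ V) (hα0 : 0 < α)
    {u : V} (hu : ‖u‖ = 1) {g : ℝ → ℝ} (hg : MemLp g 2 (gegenbauerMeasure (α + 1 / 2))) :
    (memLp_zonalField hα hα0.le hu hg).toLp ∈ closure (Submodule.span ℝ (Set.range fun l =>
      polynomialZonalField u (derivative (gegenbauerPoly α l))) :
        Set (Lp V 2 (volume : Measure V).toSphere)) := by
  have hspan : ∀ p, polynomialZonalField u p ∈ Submodule.span ℝ (Set.range fun l =>
      polynomialZonalField u (derivative (gegenbauerPoly α l))) := fun p => by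
    rw [Set.range_comp' (polynomialZonalField u) fun l => derivative (gegenbauerPoly α l),
      Submodule.span_image, span_derivative_gegenbauerPoly hα0]
    exact Submodule.mem_map_of_mem Submodule.mem_top
  set c := (sphereRatio V (α - 1 / 2)).toReal with hc
  have hc0 : 0 ≤ c := ENNReal.toReal_nonneg
  refine Metric.mem_closure_iff.2 fun ε hε => ?_
  obtain ⟨p, hp⟩ := exists_eval_eLpNorm_sub_lt (β := α + 1 / 2) (by linarith) hg
    (ε := ε / (c + 1)) (by positivity)
  refine ⟨_, hspan p, ?_⟩
  have hd : MemLp (fun x => g x - p.eval x) 2 (gegenbauerMeasure (α + 1 / 2)) :=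
    hg.sub (memLp_eval_gegenbauerMeasure (by linarith) p 2)
  have hsub : (memLp_zonalField hα hα0.le hu hg).toLp - polynomialZonalField u p =
      (memLp_zonalField hα hα0.le hu hd).toLp := by
    change _ - (memLp_zonalField_eval u p).toLp = _
    rw [← MemLp.toLp_sub]
    congr 1
    ext v
    simp [zonalField, sub_smul]
  have hnorm : ‖(memLp_zonalField hα hα0.le hu hd).toLp‖ ^ 2 = c * ‖hd.toLp‖ ^ 2 := by
    rw [← real_inner_self_eq_norm_sq, ← real_inner_self_eq_norm_sq, inner_toLp_zonalField,
      integral_inner_zonalField hα hα0.le hu hd.aestronglyMeasurable hd.aestronglyMeasurable,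
      L2.inner_def]
    congr 1
    refine integral_congr_ae ?_
    filter_upwards [hd.coeFn_toLp] with x hx
    rw [hx]
    simp
    ring
  have hlt : ‖hd.toLp‖ < ε / (c + 1) := by
    rw [Lp.norm_toLp]
    exact ENNReal.toReal_lt_of_lt_ofReal hp
  rw [dist_eq_norm, hsub]
  refine lt_of_pow_lt_pow_left₀ 2 hε.le ?_
  rw [hnorm]
  calc c * ‖hd.toLp‖ ^ 2 ≤ c * (ε / (c + 1)) ^ 2 := by gcongr
    _ < ε ^ 2 := by
      rw [div_pow, mul_div_assoc', div_lt_iff₀ (by positivity)]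
      nlinarith [pow_pos hε 2, mul_pos (pow_pos hε 2) (show 0 < c ^ 2 + c + 1 by positivity)]

/-- The Gegenbauer expansion of the zonal field of a weak derivative. -/
theorem hasSum_toLp_zonalField [Nontrivial V] (hα : 2 * α + 2 = Module.finrank ℝ V) (hα1 : 1 / 2 ≤ α)
    {f g : ℝ → ℝ} {b : ℕ → ℝ}
    (h : ∀ ψ : ℝ → ℝ, ContDiff ℝ ∞ ψ → HasCompactSupport ψ → tsupport ψ ⊆ Ioo (-1) 1 →
      ∫ x in Ioo (-1 : ℝ) 1, f x * deriv ψ x = - ∫ x in Ioo (-1 : ℝ) 1, g x * ψ x)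
    (hf : MemLp f 2 (gegenbauerMeasure α)) (hg : MemLp g 2 (gegenbauerMeasure (α + 1 / 2)))
    (hb : Tendsto (fun n : ℕ => eLpNorm
      (fun x => f x - ∑ l ∈ Finset.range n, b l * (gegenbauerPoly α l).eval x) 2
        (gegenbauerMeasure α)) atTop (𝓝 0))
    {u : V} (hu : ‖u‖ = 1) :
    HasSum (fun l => b l • polynomialZonalField u (derivative (gegenbauerPoly α l)))
      (memLp_zonalField hα (by linarith) hu hg).toLp := by
  have hα0 : 0 < α := by linarith
  have hE := isZonalForm_sphereForm hα hu hu
  have hc : (sphereRatio V (α - 1 / 2)).toReal ≠ 0 :=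
    ENNReal.toReal_ne_zero.2 ⟨sphereRatio_ne_zero (by linarith), sphereRatio_ne_top⟩
  refine hasSum_of_mem_closure_span (fun l m hlm => ?_)
    (toLp_zonalField_mem_closure_span hα hα0 hu hg) fun l => ?_
  · rw [inner_polynomialZonalField, hE.derivative_gegenbauerPoly,
      hE.gegenbauerPoly_of_ne hα0 hlm, mul_zero]
  · rw [inner_polynomialZonalField, hE.derivative_gegenbauerPoly,
      sphereForm_self hα hα0.le hu]
    refine (inner_toLp_zonalField (memLp_zonalField_eval u _) _).trans ?_
    have := isFiniteMeasure_gegenbauerMeasure (β := α + 1 / 2) (by linarith)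
    -- The derivative moves from f to (1 - x²)^(α+1/2) C_l', where the Gegenbauer equation returns
    -- the eigenvalue times C_l; only a coefficient of f remains to be found.
    have hibp := integral_eval_mul_weakDeriv h (MemLp.integrable_gegenbauerMeasure_sub_half hα1 hf)
      (by rw [show α - 1 / 2 + 1 = α + 1 / 2 by ring]; exact hg.integrable (by norm_num))
      (derivative (gegenbauerPoly α l))
    rw [show α - 1 / 2 + 1 = α + 1 / 2 by ring, show 2 * (α + 1 / 2) = 2 * α + 1 by ring,
      gegenbauerPoly_ode] at hibp
    rw [integral_inner_zonalField hα hα0.le hu (β := α + 1 / 2)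
      (Polynomial.continuous _).aestronglyMeasurable hg.aestronglyMeasurable, hibp]
    -- Orthogonality on the interval is that on the sphere with both poles equal, divided by the
    -- nonzero mass ratio.
    have hcoeff := integral_eval_mul_eq_coeff hα1 (P := gegenbauerPoly α) (fun i j hij => by
      have := hE.gegenbauerPoly_of_ne hα0 hij
      rw [sphereForm_self hα hα0.le hu] at this
      exact (mul_eq_zero.1 this).resolve_left hc) hf hb l
    simp only [eval_neg, eval_mul, eval_C, neg_mul, integral_neg, neg_neg, mul_assoc,
      integral_const_mul]
    rw [hcoeff]
    ring

/-- The Dirichlet form of two zonal functions with the same Gegenbauer expansion. -/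
theorem hasSum_integral_dirichletForm [Nontrivial V] (hα : 2 * α + 2 = Module.finrank ℝ V) (hα1 : 1 / 2 ≤ α)
    {f g : ℝ → ℝ} {b : ℕ → ℝ}
    (h : ∀ ψ : ℝ → ℝ, ContDiff ℝ ∞ ψ → HasCompactSupport ψ → tsupport ψ ⊆ Ioo (-1) 1 →
      ∫ x in Ioo (-1 : ℝ) 1, f x * deriv ψ x = - ∫ x in Ioo (-1 : ℝ) 1, g x * ψ x)
    (hf : MemLp f 2 (gegenbauerMeasure α)) (hg : MemLp g 2 (gegenbauerMeasure (α + 1 / 2)))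
    (hb : Tendsto (fun n : ℕ => eLpNorm
      (fun x => f x - ∑ l ∈ Finset.range n, b l * (gegenbauerPoly α l).eval x) 2
        (gegenbauerMeasure α)) atTop (𝓝 0))
    {u w : V} (hu : ‖u‖ = 1) (hw : ‖w‖ = 1) :
    Integrable (fun v : Metric.sphere (0 : V) 1 =>
      (inner ℝ u w - inner ℝ u v.1 * inner ℝ w v.1) * (g (inner ℝ u v.1) * g (inner ℝ w v.1)))
      (volume : Measure V).toSphere ∧
    HasSum (fun l : ℕ => (volume : Measure V).toSphere.real univ *
        (b l ^ 2 * (l * (l + 2 * α)) * (α / (l + α)) * (gegenbauerPoly α l).eval (inner ℝ u w)))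
      (∫ v : Metric.sphere (0 : V) 1,
        (inner ℝ u w - inner ℝ u v.1 * inner ℝ w v.1) * (g (inner ℝ u v.1) * g (inner ℝ w v.1))
        ∂(volume : Measure V).toSphere) := by
  have hα0 : 0 < α := by linarith
  have hE := isZonalForm_sphereForm hα hu hw
  have hgu := memLp_zonalField hα hα0.le hu hg
  have hgw := memLp_zonalField hα hα0.le hw hg
  simp_rw [← inner_zonalField]
  constructor
  · refine (L2.integrable_inner (𝕜 := ℝ) hgu.toLp hgw.toLp).congr ?_
    filter_upwards [hgu.coeFn_toLp, hgw.coeFn_toLp] with v h1 h2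
    rw [h1, h2]
  · rw [← inner_toLp_zonalField hgu hgw]
    have hs := (hasSum_toLp_zonalField hα hα1 h hf hg hb hu).inner_biorthogonal
      (hasSum_toLp_zonalField hα hα1 h hf hg hb hw) fun l m hlm => by
        rw [inner_smul_left, inner_smul_right, inner_polynomialZonalField,
          hE.derivative_gegenbauerPoly, hE.gegenbauerPoly_of_ne hα0 hlm]
        simp
    refine hs.congr_fun fun l => ?_
    have hself := hE.gegenbauerPoly_self hα0 l
    rw [sphereForm_one_one] at hself
    have hne : (l : ℝ) + α ≠ 0 := by positivity
    rw [inner_smul_left, inner_smul_right, inner_polynomialZonalField,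
      hE.derivative_gegenbauerPoly, RCLike.conj_to_real]
    have hself' : sphereForm u w (gegenbauerPoly α l) (gegenbauerPoly α l) =
        (volume : Measure V).toSphere.real univ *
          (α * (gegenbauerPoly α l).eval (inner ℝ u w)) / (l + α) := by
      rw [eq_div_iff hne, mul_comm, hself]
    rw [hself']
    ring

end TangentialFields

/-! ### Rescaling to (-1, 1) and matching of constants. -/

/-- Both sides are asserted to make sense: the integrand is integrable on the sphere `S^{B-2}`
and the series converges (absolutely) to its average. -/
theorem mainTheorem12 (B : ℕ) (hB : 4 ≤ B)
    (φ φ' : ℝ → ℝ) (a : ℕ → ℝ)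
    (hderiv : IsWeakDerivOn (Set.Ioo (-√((B : ℝ) - 1)) (√((B : ℝ) - 1))) φ φ')
    (hφ : MemLp (fun x => φ (√((B : ℝ) - 1) * x)) 2 (gegenbauerMeasure (((B : ℝ) - 3) / 2)))
    (hφ' : MemLp (fun x => φ' (√((B : ℝ) - 1) * x)) 2 (gegenbauerMeasure (((B : ℝ) - 3) / 2)))
    (ha : HasGegenbauerExpansion B (fun x => φ (√((B : ℝ) - 1) * x)) a)
    (u₁ u₂ : Metric.sphere (0 : EuclideanSpace ℝ (Fin (B - 1))) 1) :
    Integrable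
      (fun v : Metric.sphere (0 : EuclideanSpace ℝ (Fin (B - 1))) 1 =>
        (inner ℝ u₁.1 u₂.1 - inner ℝ u₁.1 v.1 * inner ℝ u₂.1 v.1) *
          φ' (√((B : ℝ) - 1) * inner ℝ u₁.1 v.1) * φ' (√((B : ℝ) - 1) * inner ℝ u₂.1 v.1))
      (sphereMeasure (B - 1)) ∧
    HasSum
      (fun l : ℕ =>
        (a l) ^ 2 * (((l : ℝ) + (B : ℝ) - 3) / ((B : ℝ) - 1)) * (l : ℝ) *
          (zonalConst ((B : ℝ) - 1) l)⁻¹ *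
          (gegenbauerPoly (((B : ℝ) - 3) / 2) l).eval (inner ℝ u₁.1 u₂.1))
      (⨍ v : Metric.sphere (0 : EuclideanSpace ℝ (Fin (B - 1))) 1,
        (inner ℝ u₁.1 u₂.1 - inner ℝ u₁.1 v.1 * inner ℝ u₂.1 v.1) *
          φ' (√((B : ℝ) - 1) * inner ℝ u₁.1 v.1) * φ' (√((B : ℝ) - 1) * inner ℝ u₂.1 v.1)
        ∂(sphereMeasure (B - 1))) := by
  have hB' : (4 : ℝ) ≤ B := by exact_mod_cast hB
  have hnt : Nontrivial (EuclideanSpace ℝ (Fin (B - 1))) :=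
    Module.nontrivial_of_finrank_pos (R := ℝ) (by rw [finrank_euclideanSpace_fin]; omega)
  set r : ℝ := √((B : ℝ) - 1) with hr
  have hr0 : 0 < r := Real.sqrt_pos.2 (by linarith)
  have hr2 : r ^ 2 = (B : ℝ) - 1 := Real.sq_sqrt (by linarith)
  set α : ℝ := ((B : ℝ) - 3) / 2 with hα
  have hα1 : 1 / 2 ≤ α := by rw [hα]; linarith
  have hdim : 2 * α + 2 = Module.finrank ℝ (EuclideanSpace ℝ (Fin (B - 1))) := by
    rw [finrank_euclideanSpace_fin, Nat.cast_sub (by omega), hα]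
    push_cast
    ring
  -- The factor r comes from the chain rule for φ(r x); the larger exponent gives a smaller measure.
  have hg : MemLp (fun x => r * φ' (r * x)) 2 (gegenbauerMeasure (α + 1 / 2)) :=
    (hφ'.const_mul r).mono_measure (gegenbauerMeasure_anti (by linarith))
  -- Here b_l = a_l / c_{B-1,l}. Since α/(l+α) = c_{B-1,l}, one of the two inverse factors in b_l²
  -- cancels; the two chain-rule factors give r² = B - 1, hence the denominator.
  obtain ⟨hint, hsum⟩ := hasSum_integral_dirichletForm hdim hα1
    (fun ψ h1 h2 h3 => hderiv.integral_comp_mul hr0 h1 h2 h3) hφ hg ha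
    (norm_eq_of_mem_sphere u₁) (norm_eq_of_mem_sphere u₂)
  have hscale : ∀ v : Metric.sphere (0 : EuclideanSpace ℝ (Fin (B - 1))) 1,
      (inner ℝ u₁.1 u₂.1 - inner ℝ u₁.1 v.1 * inner ℝ u₂.1 v.1) *
          φ' (r * inner ℝ u₁.1 v.1) * φ' (r * inner ℝ u₂.1 v.1) =
        ((B : ℝ) - 1)⁻¹ * ((inner ℝ u₁.1 u₂.1 - inner ℝ u₁.1 v.1 * inner ℝ u₂.1 v.1) *
          (r * φ' (r * inner ℝ u₁.1 v.1) * (r * φ' (r * inner ℝ u₂.1 v.1)))) := fun v => by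
    rw [← hr2]
    field_simp
  have hmass : (sphereMeasure (B - 1)).real Set.univ ≠ 0 := by
    rw [measureReal_def, ENNReal.toReal_ne_zero]
    exact ⟨Measure.measure_univ_ne_zero.2 (Measure.toSphere_ne_zero _),
      measure_ne_top (volume : Measure (EuclideanSpace ℝ (Fin (B - 1)))).toSphere _⟩
  simp_rw [hscale]
  refine ⟨hint.const_mul _, ?_⟩
  rw [average_eq, smul_eq_mul, integral_const_mul]
  refine ((hsum.mul_left ((B : ℝ) - 1)⁻¹).mul_left
    ((sphereMeasure (B - 1)).real Set.univ)⁻¹).congr_fun fun l => ?_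
  have hl : (0 : ℝ) ≤ l := l.cast_nonneg
  have h1 : (B : ℝ) - 1 ≠ 0 := by linarith
  have h2 : (B : ℝ) - 3 ≠ 0 := by linarith
  have h3 : (B : ℝ) - 3 + 2 * l ≠ 0 := by linarith
  have hz : (zonalConst ((B : ℝ) - 1) l)⁻¹ = (B - 3 + 2 * l) / (B - 3) := by
    rw [zonalConst, inv_div]
    congr 1 <;> ring
  have hα' : α / (l + α) = (B - 3) / (B - 3 + 2 * l) := by
    rw [show (l : ℝ) + α = (B - 3 + 2 * l) / 2 by rw [hα]; ring, hα,
      div_div_div_cancel_right₀ two_ne_zero]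
  change _ = ((sphereMeasure (B - 1)).real Set.univ)⁻¹ * (((B : ℝ) - 1)⁻¹ *
    ((sphereMeasure (B - 1)).real Set.univ * _))
  rw [hz, hα', show (l : ℝ) + 2 * α = l + B - 3 by rw [hα]; ring]
  field_simp
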